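/- Let $X$ be a compact complex manifold of dimension $n$ with Kähler form $\omega$, and let $\alpha$ be a smooth closed real $(1,1)$-form on $X$ such that $Z:=\int_X(\omega+\sqrt{-1}\,\alpha)^n\neq 0$. For $\phi\in C^\infty(X,\mathbb R)$ put $\alpha_\phi=\alpha+\sqrt{-1}\,\partial\bar\partial\phi$. Let $e^{\sqrt{-1}\hat\theta}=Z/|Z|$ and $$\mathcal H=\{\phi\in C^\infty(X,\mathbb R):\ \mathrm{Re}\big(e^{-\sqrt{-1}\hat\theta}(\omega+\sqrt{-1}\,\alpha_\phi)^n\big)>0\},$$ where positivity is that of a volume form with respect to the complex orientation. Consider the $1$-form on $C^\infty(X,\mathbb R)$ $$dCY_{\mathbb C}(\phi)(\psi)=\int_X\psi\,(\omega+\sqrt{-1}\,\alpha_\phi)^n,\qquad \phi,\psi\in C^\infty(X,\mathbb R).$$ A smooth path in $C^\infty(X,\mathbb R)$ is a family $(\gamma_t)_{t\in\mathbb R}$ such that $(t,x)\mapsto\gamma_t(x)$ is smooth on $\mathbb R\times X$, and a primitive of $dCY_{\mathbb C}$ is a function $F:C^\infty(X,\mathbb R)\to\mathbb C$ such that, for every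 smooth path $\gamma$ and every $t$, $F(\gamma_t)$ is differentiable in $t$ with $\frac{d}{dt}F(\gamma_t)=dCY_{\mathbb C}(\gamma_t)(\dot\gamma_t)$. 1. The $1$-form $dCY_{\mathbb C}$ is exact on $C^\infty(X,\mathbb R)$: for every $\phi_0\in C^\infty(X,\mathbb R)$ it has exactly one primitive $F$ with $F(\phi_0)=0$. 2. Hence $dCY_{\mathbb C}$ integrates to a well-defined functional on $\mathcal H$: for every base point $\phi_0\in\mathcal H$ there is exactly one function $CY_{\mathbb C}:\mathcal H\to\mathbb C$ such that, for every $\phi_1\in\mathcal H$ and every smooth path $\gamma$ in $C^\infty(X,\mathbb R)$ with $\gamma_0=\phi_0$ and $\gamma_1=\phi_1$, the function $t\mapsto dCY_{\mathbb C}(\gamma_t)(\dot\gamma_t)$ is integrable on $[0,1]$ and $$CY_{\mathbb C}(\phi_1)=\int_0^1 dCY_{\mathbb C}(\gamma_t)(\dot\gamma_t)\,dt;$$ it is the restriction to $\mathcal H$ of the primitive $F$ with $F(\phi_0)=0$. 3. The primitive $F$ with $F(0)=0$ is given, for all $\phi\in C^\infty(X,\mathbb R)$, by $$F(\phi)=\frac1{n+1}\sum_{j=0}^n\int_X\phi\,(\omega+\sqrt{-1}\,\alpha_\phi)^j\wedge(\omega+\sqrt{-1}\,\alpha)^{n-j}.$$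 In particular, if $0\in\mathcal H$, then the functional $CY_{\mathbb C}$ on $\mathcal H$ with base point $0$ is given by this formula for all $\phi\in\mathcal H$. -/

import Mathlib

open scoped Manifold ContDiff

/-- The model space `ℂⁿ`. A compact complex manifold of dimension `n` is a compact Hausdorff space
charted on `Cn n` with holomorphic transition maps. The same charts, with the model with corners
`𝓘(ℝ, Cn n)`, give the underlying smooth real manifold. -/
abbrev Cn (n : ℕ) : Type := Fin n → ℂ

/-- The underlying real smooth structure of a complex manifold. -/
theorem isManifold_real_of_complex (n : ℕ) (X : Type*) [TopologicalSpace X]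
    [ChartedSpace (Cn n) X] [IsManifold 𝓘(ℂ, Cn n) ω X] : IsManifold 𝓘(ℝ, Cn n) ∞ X := by
  refine isManifold_of_contDiffOn _ _ _ fun e e' he he' => ?_
  have h := contDiffGroupoid ω 𝓘(ℂ, Cn n) |>.compatible he he'
  have h1 : e.symm ≫ₕ e' ∈ contDiffGroupoid ∞ 𝓘(ℂ, Cn n) := contDiffGroupoid_le le_top h
  rw [contDiffGroupoid, mem_groupoid_of_pregroupoid] at h1
  exact ContDiffOn.restrict_scalars ℝ h1.1

noncomputable section

/-- Multiplication by `√-1` on `ℂⁿ`, as a real linear map. -/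
def mulI (n : ℕ) : Cn n →L[ℝ] Cn n :=
  Complex.I • ContinuousLinearMap.id ℝ (Cn n)

/-- Smooth real-valued functions on `X`. -/
abbrev SmoothFn (n : ℕ) (X : Type*) [TopologicalSpace X] [ChartedSpace (Cn n) X] :=
  C^∞⟮𝓘(ℝ, Cn n), X; 𝓘(ℝ, ℝ), ℝ⟯

/-- Complex-valued alternating `ι`-multilinear forms on the real tangent spaces of `X`
(no regularity is imposed here). -/
abbrev DiffForm (n : ℕ) (X : Type*) [TopologicalSpace X] [ChartedSpace (Cn n) X] (ι : Type) :=
  (x : X) → TangentSpace 𝓘(ℝ, Cn n) x [⋀^ι]→L[ℝ] ℂ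

/-- Complex-valued differential 2-forms. -/
abbrev TwoForm (n : ℕ) (X : Type*) [TopologicalSpace X] [ChartedSpace (Cn n) X] :=
  DiffForm n X (Fin 2)

/-- Complex-valued differential forms of top degree `2n`. The `2n` slots are indexed by
`Fin n × Fin 2`, in the order `(0,0), (0,1), (1,0), (1,1), …`. -/
abbrev TopForm (n : ℕ) (X : Type*) [TopologicalSpace X] [ChartedSpace (Cn n) X] :=
  DiffForm n X (Fin n × Fin 2)

section Manifold

variable {n : ℕ} {X : Type*} [TopologicalSpace X] [ChartedSpace (Cn n) X]

/-- The expression of a form in a chart `e`: its pull-back by `e.symm`, a form on `ℂⁿ`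
(meaningful on `e.target`). -/
def DiffForm.inChart {ι : Type} (β : DiffForm n X ι) (e : OpenPartialHomeomorph X (Cn n))
    (y : Cn n) : Cn n [⋀^ι]→L[ℝ] ℂ :=
  (β (e.symm y)).compContinuousLinearMap (mfderiv 𝓘(ℝ, Cn n) 𝓘(ℝ, Cn n) e.symm y)

/-- A 2-form is smooth if it is smooth in every chart of the atlas. -/
def TwoForm.IsSmooth (β : TwoForm n X) : Prop :=
  ∀ e ∈ atlas (Cn n) X, ContDiffOn ℝ ∞ (DiffForm.inChart β e) e.target

/-- A 2-form is closed if its exterior derivative vanishes in every chart of the atlas. -/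
def TwoForm.IsClosed (β : TwoForm n X) : Prop :=
  ∀ e ∈ atlas (Cn n) X, ∀ y ∈ e.target, extDeriv (DiffForm.inChart β e) y = 0

/-- A 2-form is real if it takes real values on real tangent vectors. -/
def TwoForm.IsReal (β : TwoForm n X) : Prop :=
  ∀ (x : X) (u v : TangentSpace 𝓘(ℝ, Cn n) x), (β x ![u, v]).im = 0

/-- The complex structure of the tangent space `T_x X`. -/
def tangentJ (x : X) : TangentSpace 𝓘(ℝ, Cn n) x →L[ℝ] TangentSpace 𝓘(ℝ, Cn n) x :=
  mulI n

/-- A 2-form has type `(1,1)` iff it is invariant under the complex structure `J`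
(on forms of type `(2,0)` or `(0,2)`, `J` acts by `-1`). -/
def TwoForm.IsOneOne (β : TwoForm n X) : Prop :=
  ∀ (x : X) (u v : TangentSpace 𝓘(ℝ, Cn n) x), β x ![tangentJ x u, tangentJ x v] = β x ![u, v]

/-- Smooth closed real forms of type `(1,1)`. -/
structure IsClosedRealOneOne (β : TwoForm n X) : Prop where
  smooth : TwoForm.IsSmooth β
  closed : TwoForm.IsClosed β
  real : TwoForm.IsReal β
  oneOne : TwoForm.IsOneOne β

/-- Kähler forms: smooth closed real `(1,1)`-forms with `ω(v, Jv) > 0` for every `v ≠ 0`. -/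
structure IsKahlerForm (β : TwoForm n X) : Prop extends IsClosedRealOneOne β where
  pos : ∀ (x : X) (v : TangentSpace 𝓘(ℝ, Cn n) x), v ≠ 0 → 0 < (β x ![v, tangentJ x v]).re

/-- `∂̄f = ∑ₖ (∂f/∂z̄ₖ) dz̄ₖ` for a function `f` on `ℂⁿ`, i.e. the conjugate-linear part
`v ↦ (df(v) + √-1 df(√-1 v)) / 2` of its real differential. -/
def dbar {n : ℕ} (f : Cn n → ℂ) (y : Cn n) : Cn n →L[ℝ] ℂ :=
  (1 / 2 : ℂ) • (fderiv ℝ f y + Complex.I • (fderiv ℝ f y).comp (mulI n))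

/-- `∂∂̄f` for a function `f` on `ℂⁿ`; since `∂̄∂̄f = 0`, this is the exterior derivative of the
1-form `∂̄f`. -/
def deldbar {n : ℕ} (f : Cn n → ℂ) : Cn n → Cn n [⋀^Fin 2]→L[ℝ] ℂ :=
  extDeriv (n := 1) fun y => ContinuousAlternatingMap.ofSubsingleton ℝ (Cn n) ℂ (0 : Fin 1) (dbar f y)

/-- The 2-form `√-1 ∂∂̄φ` on `X`. At `x` it is computed in the preferred holomorphic chart at `x`,
which is the one that identifies `T_x X` with `ℂⁿ`. -/
def iDeldbar (φ : SmoothFn n X) : TwoForm n X := fun x =>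
  Complex.I • deldbar (fun z => ((φ ((chartAt (Cn n) x).symm z) : ℝ) : ℂ)) (chartAt (Cn n) x x)

/-- `α_φ = α + √-1 ∂∂̄φ`. -/
def alphaPhi (α : TwoForm n X) (φ : SmoothFn n X) : TwoForm n X := fun x =>
  α x + iDeldbar φ x

/-- The complexified form `ω + √-1 α`. -/
def complexified (ω₀ α : TwoForm n X) : TwoForm n X := fun x =>
  ω₀ x + Complex.I • α x

end Manifold

section Wedge

variable {V : Type*} [AddCommGroup V] [Module ℝ V] [TopologicalSpace V] {n : ℕ}

/-- The multilinear form `(v_{i,0}, v_{i,1})_i ↦ ∏ᵢ βᵢ(v_{i,0}, v_{i,1})`. -/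
def prodTwoForms (β : Fin n → V [⋀^Fin 2]→L[ℝ] ℂ) :
    ContinuousMultilinearMap ℝ (fun _ : Fin n × Fin 2 => V) ℂ where
  toFun v := ∏ i, β i (fun k => v (i, k))
  map_update_add' := by
    intro inst v p x y
    obtain ⟨i, k⟩ := p
    have key : ∀ w : V, ∀ j, (fun l => Function.update v (i, k) w (j, l)) =
        if j = i then Function.update (fun l => v (i, l)) k w else fun l => v (j, l) := by
      intro w j
      by_cases h : j = i
      · subst h
        funext l
        by_cases hl : l = k
        · subst hl; simp
        · simp [Function.update_of_ne, hl]
      · funext l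
        simp [h]
    simp only [key]
    rw [← Finset.mul_prod_erase _ _ (Finset.mem_univ i), ← Finset.mul_prod_erase _ _ (Finset.mem_univ i),
      ← Finset.mul_prod_erase _ _ (Finset.mem_univ i)]
    simp only [if_true, ContinuousAlternatingMap.map_update_add, add_mul]
    congr 1
    · congr 1
      refine Finset.prod_congr rfl fun j hj => ?_
      simp [Finset.ne_of_mem_erase hj]
    · congr 1
      refine Finset.prod_congr rfl fun j hj => ?_
      simp [Finset.ne_of_mem_erase hj]
  map_update_smul' := by
    intro inst v p c x
    obtain ⟨i, k⟩ := p
    have key : ∀ w : V, ∀ j, (fun l => Function.update v (i, k) w (j, l)) =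
        if j = i then Function.update (fun l => v (i, l)) k w else fun l => v (j, l) := by
      intro w j
      by_cases h : j = i
      · subst h
        funext l
        by_cases hl : l = k
        · subst hl; simp
        · simp [Function.update_of_ne, hl]
      · funext l
        simp [h]
    simp only [key]
    rw [← Finset.mul_prod_erase _ _ (Finset.mem_univ i), ← Finset.mul_prod_erase _ _ (Finset.mem_univ i)]
    simp only [if_true, ContinuousAlternatingMap.map_update_smul, smul_mul_assoc]
    congr 2
    refine Finset.prod_congr rfl fun j hj => ?_
    simp [Finset.ne_of_mem_erase hj]
  cont := by
    refine continuous_finsetProd _ fun i _ => (β i).cont.comp ?_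
    exact continuous_pi fun k => continuous_apply (i, k)

/-- The wedge product `β₀ ∧ ⋯ ∧ βₙ₋₁` of `n` two-forms:
`(v₁, …, v₂ₙ) ↦ 2⁻ⁿ ∑_σ sgn(σ) ∏ᵢ βᵢ(v_σ(2i-1), v_σ(2i))`. -/
def wedgeTwoForms (β : Fin n → V [⋀^Fin 2]→L[ℝ] ℂ) : V [⋀^Fin n × Fin 2]→L[ℝ] ℂ :=
  ((2 : ℝ) ^ n)⁻¹ • ContinuousMultilinearMap.alternatization (prodTwoForms β)

end Wedge

section Integration

variable {n : ℕ} {X : Type*} [TopologicalSpace X] [ChartedSpace (Cn n) X]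

/-- The top-degree form `A^j ∧ B^(n-j)` (for `j ≤ n`), for 2-forms `A` and `B`. -/
def mixedPower (A B : TwoForm n X) (j : ℕ) : TopForm n X := fun x =>
  wedgeTwoForms fun i : Fin n => if (i : ℕ) < j then A x else B x

/-- The top-degree form `A^n`. -/
def topPower (A : TwoForm n X) : TopForm n X := fun x =>
  wedgeTwoForms fun _ : Fin n => A x

/-- The product of a function and a top-degree form. -/
def fnMul (f : SmoothFn n X) (η : TopForm n X) : TopForm n X := fun x => f x • η x

/-- The positively oriented real frame `∂/∂x₁, ∂/∂y₁, …, ∂/∂xₙ, ∂/∂yₙ` of `ℂⁿ`. -/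
def stdFrame (n : ℕ) : Fin n × Fin 2 → Cn n := fun p =>
  Pi.single p.1 (if p.2 = 0 then 1 else Complex.I)

variable (n X) in
/-- Smooth partitions of unity subordinate to the preferred charts exist. -/
theorem exists_chartPartition [T2Space X] [CompactSpace X] [IsManifold 𝓘(ℂ, Cn n) ω X] :
    ∃ ρ : SmoothPartitionOfUnity X 𝓘(ℝ, Cn n) X Set.univ,
      ρ.IsSubordinate fun x => (chartAt (Cn n) x).source :=
  haveI := isManifold_real_of_complex n X
  SmoothPartitionOfUnity.exists_isSubordinate_chartAt_source 𝓘(ℝ, Cn n) X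

variable (n X) in
/-- A smooth partition of unity subordinate to the preferred charts. -/
def chartPartition [T2Space X] [CompactSpace X] [IsManifold 𝓘(ℂ, Cn n) ω X] :
    SmoothPartitionOfUnity X 𝓘(ℝ, Cn n) X Set.univ :=
  (exists_chartPartition n X).choose

/-- The integral over `X`, with its complex orientation, of a top-degree form `η`:
`∑_c ∫_{e_c} ρ_c η`, where `ρ` is a partition of unity subordinate to the charts `e_c`, and a form
`g dx₁ ∧ dy₁ ∧ ⋯ ∧ dxₙ ∧ dyₙ` on an open subset of `ℂⁿ` is integrated by integrating `g` with respect
to Lebesgue measure. For continuous `η` the value does not depend on the partition of unity. -/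
def integralForm [T2Space X] [CompactSpace X] [IsManifold 𝓘(ℂ, Cn n) ω X] (η : TopForm n X) : ℂ :=
  ∑ᶠ c : X, ∫ y in (chartAt (Cn n) c).target,
    chartPartition n X c ((chartAt (Cn n) c).symm y) •
      DiffForm.inChart η (chartAt (Cn n) c) y (stdFrame n)

variable [T2Space X] [CompactSpace X] [IsManifold 𝓘(ℂ, Cn n) ω X]

/-- The 1-form `dCY_ℂ(φ)(ψ) = ∫_X ψ (ω + √-1 α_φ)ⁿ` on `C^∞(X, ℝ)`. -/
def dCY (ω₀ α : TwoForm n X) (φ ψ : SmoothFn n X) : ℂ :=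
  integralForm (fnMul ψ (topPower (complexified ω₀ (alphaPhi α φ))))

/-- `∫_X (ω + √-1 α)ⁿ`. -/
def totalIntegral (ω₀ α : TwoForm n X) : ℂ :=
  integralForm (topPower (complexified ω₀ α))

/-- The unit complex number `e^{√-1 θ̂}` with `∫_X (ω + √-1 α)ⁿ ∈ ℝ_{>0} e^{√-1 θ̂}`
(meaningful when the integral is nonzero). -/
def phase (ω₀ α : TwoForm n X) : ℂ :=
  totalIntegral ω₀ α / ‖totalIntegral ω₀ α‖

/-- The space `𝓗` of all `φ ∈ C^∞(X, ℝ)` with `Re(e^{-√-1 θ̂} (ω + √-1 α_φ)ⁿ) > 0`, as a volume form: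
positive on the positively oriented frame of `T_x X` at each point `x`. -/
def spaceH (ω₀ α : TwoForm n X) : Set (SmoothFn n X) :=
  {φ | ∀ x : X, 0 <
    ((phase ω₀ α)⁻¹ * topPower (complexified ω₀ (alphaPhi α φ)) x (stdFrame n)).re}

end Integration

section Paths

/-- A smooth path in `C^∞(X, ℝ)`: a family `γ_t` such that `(t, x) ↦ γ_t(x)` is smooth. -/
structure SmoothPath (n : ℕ) (X : Type*) [TopologicalSpace X] [ChartedSpace (Cn n) X] where
  toFun : ℝ → SmoothFn n X
  smooth : ContMDiff (𝓘(ℝ, ℝ).prod 𝓘(ℝ, Cn n)) 𝓘(ℝ, ℝ) ∞ fun p : ℝ × X => toFun p.1 p.2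

variable {n : ℕ} {X : Type*} [TopologicalSpace X] [ChartedSpace (Cn n) X]
  [IsManifold 𝓘(ℂ, Cn n) ω X]

/-- The velocity `∂γ_t/∂t ∈ C^∞(X, ℝ)` of a smooth path. -/
def SmoothPath.velocity (γ : SmoothPath n X) (t : ℝ) : SmoothFn n X where
  val := fun x => deriv (fun s => γ.toFun s x) t
  property := by
    intro x₀
    have : IsManifold 𝓘(ℝ, Cn n) ∞ X := isManifold_real_of_complex n X
    have : IsManifold 𝓘(ℝ, Cn n) 1 X := IsManifold.of_le (n := ∞) (by simp)
    have h := ContMDiffAt.mfderiv (I := 𝓘(ℝ, ℝ)) (I' := 𝓘(ℝ, ℝ)) (J := 𝓘(ℝ, Cn n)) (m := ∞) (n := ∞)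
      (x₀ := x₀) (fun (x : X) (s : ℝ) => γ.toFun s x) (fun _ => t)
      ((γ.smooth.comp (contMDiff_snd.prodMk contMDiff_fst)) (x₀, t)) contMDiffAt_const le_rfl
    have h2 := h.clm_apply (contMDiffAt_const (c := (1 : ℝ)))
    refine h2.congr_of_eventuallyEq (Filter.Eventually.of_forall fun x => ?_)
    simp [inTangentCoordinates_model_space, mfderiv_eq_fderiv]

/-- `F` is a primitive of the 1-form `θ` on `C^∞(X, ℝ)`, that is, `dF = θ`: the derivative of `F`
along each smooth path `γ` is `θ(γ_t)(∂γ_t/∂t)`. -/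
def IsPrimitive (F : SmoothFn n X → ℂ) (θ : SmoothFn n X → SmoothFn n X → ℂ) : Prop :=
  ∀ (γ : SmoothPath n X) (t : ℝ),
    HasDerivAt (fun s => F (γ.toFun s)) (θ (γ.toFun t) (γ.velocity t)) t

variable [T2Space X] [CompactSpace X]

/-- `CY : 𝓗 → ℂ` is the functional obtained by integrating `dCY_ℂ` from the base point `φ₀`: its value
at `φ₁ ∈ 𝓗` is the integral of `dCY_ℂ` along any smooth path in `C^∞(X, ℝ)` from `φ₀` to `φ₁`. -/
def IsCYFunctional (ω₀ α : TwoForm n X) (φ₀ : SmoothFn n X) (CY : spaceH ω₀ α → ℂ) : Prop :=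
  ∀ (φ₁ : spaceH ω₀ α) (γ : SmoothPath n X), γ.toFun 0 = φ₀ → γ.toFun 1 = φ₁ →
    IntervalIntegrable (fun t => dCY ω₀ α (γ.toFun t) (γ.velocity t)) MeasureTheory.volume 0 1 ∧
      CY φ₁ = ∫ t in (0 : ℝ)..1, dCY ω₀ α (γ.toFun t) (γ.velocity t)

/-- `(1/(n+1)) ∑_{j=0}^n ∫_X φ (ω + √-1 α_φ)^j ∧ (ω + √-1 α)^(n-j)`. -/
def explicitCY (ω₀ α : TwoForm n X) (φ : SmoothFn n X) : ℂ :=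
  1 / ((n : ℂ) + 1) * ∑ j ∈ Finset.range (n + 1),
    integralForm (fnMul φ
      (mixedPower (complexified ω₀ (alphaPhi α φ)) (complexified ω₀ α) j))

end Paths

end

/-! ### Algebra of wedge products of two-forms. -/

section WedgeAlgebra

variable {V W : Type*} [AddCommGroup V] [Module ℝ V] [TopologicalSpace V]
  [AddCommGroup W] [Module ℝ W] [TopologicalSpace W] {n : ℕ}

/-! Write A = ω + √-1 α and B_φ = ω + √-1 α_φ, so that B_φ - A = √-1 · (√-1∂∂̄φ). Exactness is
proved by differentiating the explicit formula along an arbitrary smooth path; closedness of the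
1-form is never tested separately.

Let φ = γ_t, ψ = ∂γ_t/∂t, B = B_φ and a_j = ∫ ψ B^j ∧ A^(n-j). The t-derivative of ∫ φ B^j ∧ A^(n-j)
is a_j plus one term ∫ φ (√-1 · √-1∂∂̄ψ) ∧ B^(j-1) ∧ A^(n-j) for each of the j factors B. The
operator ∂∂̄ is symmetric against closed (1,1)-forms, so φ and ψ may be exchanged there. Then √-1 ·
√-1∂∂̄φ = B - A appears, and the j terms add up to j (a_j - a_(j-1)). The sum over j of a_j + j (a_j
- a_(j-1)) telescopes to (n+1) a_n, which is (n+1) dCY(φ)(ψ). See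
`hasDerivAt_integralForm_mixedPower`, `sum_telescope` and `isPrimitive_explicitCY`.

The analytic core is the symmetry `integralForm_wedge_iDeldbar_comm`. A partition of unity reduces
it to φ supported in one chart. There, with dᶜf = df ∘ J, the form φ ∂∂̄ψ - ψ ∂∂̄φ differs from the
exact form dσ, σ = (√-1/2)(φ dᶜψ - ψ dᶜφ), by a J-anti-invariant two-form. The latter wedges to zero
with J-invariant forms, since J has determinant 1 (`wedgeTwoForms_update_eq_zero`). The exact part
integrates to zero by Stokes, the remaining factors being closed
(`setIntegral_wedge_extDeriv_eq_zero`).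

The rest is formal. Two primitives agreeing at one point agree everywhere, because any two functions
are joined by a straight path (`IsPrimitive.eq_of_eq`). The functional on 𝓗 comes from the
fundamental theorem of calculus, the integrand being continuous in t. -/

theorem wedgeTwoForms_apply (β : Fin n → V [⋀^Fin 2]→L[ℝ] ℂ) (v : Fin n × Fin 2 → V) :
    wedgeTwoForms β v = ((2 : ℝ) ^ n)⁻¹ • ∑ s : Equiv.Perm (Fin n × Fin 2),
      Equiv.Perm.sign s • ∏ i, β i (fun k => v (s (i, k))) := by
  simp only [wedgeTwoForms, ContinuousAlternatingMap.smul_apply,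
    ContinuousMultilinearMap.alternatization_apply_apply]
  rfl

theorem wedgeTwoForms_compContinuousLinearMap (β : Fin n → V [⋀^Fin 2]→L[ℝ] ℂ) (L : W →L[ℝ] V) :
    (wedgeTwoForms β).compContinuousLinearMap L =
      wedgeTwoForms fun i => (β i).compContinuousLinearMap L := by
  ext v
  simp only [ContinuousAlternatingMap.compContinuousLinearMap_apply, wedgeTwoForms_apply]
  rfl

theorem prod_update_apply (β : Fin n → V [⋀^Fin 2]→L[ℝ] ℂ) (i : Fin n) (x : V [⋀^Fin 2]→L[ℝ] ℂ)
    (v : Fin n → Fin 2 → V) :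
    ∏ j, Function.update β i x j (v j) = x (v i) * ∏ j ∈ Finset.univ.erase i, β j (v j) := by
  rw [← Finset.mul_prod_erase _ _ (Finset.mem_univ i)]
  simp only [Function.update_self]
  congr 1
  exact Finset.prod_congr rfl fun j hj => by rw [Function.update_of_ne (Finset.ne_of_mem_erase hj)]

/-- Isolates the i-th factor, so that linearity in it, also over ℂ, can be read off term by term. -/
theorem wedgeTwoForms_update_apply (β : Fin n → V [⋀^Fin 2]→L[ℝ] ℂ) (i : Fin n)
    (x : V [⋀^Fin 2]→L[ℝ] ℂ) (v : Fin n × Fin 2 → V) :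
    wedgeTwoForms (Function.update β i x) v =
      ((2 : ℝ) ^ n)⁻¹ • ∑ s : Equiv.Perm (Fin n × Fin 2), Equiv.Perm.sign s •
        (x (fun k => v (s (i, k))) *
          ∏ j ∈ Finset.univ.erase i, β j (fun k => v (s (j, k)))) := by
  rw [wedgeTwoForms_apply]
  congr 1
  refine Finset.sum_congr rfl fun s _ => ?_
  rw [prod_update_apply β i x fun j k => v (s (j, k))]

theorem wedgeTwoForms_update_add (β : Fin n → V [⋀^Fin 2]→L[ℝ] ℂ) (i : Fin n)
    (x y : V [⋀^Fin 2]→L[ℝ] ℂ) :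
    wedgeTwoForms (Function.update β i (x + y)) =
      wedgeTwoForms (Function.update β i x) + wedgeTwoForms (Function.update β i y) := by
  ext v
  simp only [ContinuousAlternatingMap.add_apply, wedgeTwoForms_update_apply, add_mul, smul_add,
    Finset.sum_add_distrib]

theorem wedgeTwoForms_update_smul (β : Fin n → V [⋀^Fin 2]→L[ℝ] ℂ) (i : Fin n) (c : ℂ)
    (x : V [⋀^Fin 2]→L[ℝ] ℂ) :
    wedgeTwoForms (Function.update β i (c • x)) = c • wedgeTwoForms (Function.update β i x) := by
  ext v
  simp only [ContinuousAlternatingMap.smul_apply, wedgeTwoForms_update_apply, smul_eq_mul]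
  rw [mul_smul_comm, Finset.mul_sum]
  congr 1
  refine Finset.sum_congr rfl fun s _ => ?_
  rw [mul_smul_comm, mul_assoc]

theorem wedgeTwoForms_update_sub (β : Fin n → V [⋀^Fin 2]→L[ℝ] ℂ) (i : Fin n)
    (x y : V [⋀^Fin 2]→L[ℝ] ℂ) :
    wedgeTwoForms (Function.update β i (x - y)) =
      wedgeTwoForms (Function.update β i x) - wedgeTwoForms (Function.update β i y) := by
  have h := wedgeTwoForms_update_add β i (x - y) y
  rw [sub_add_cancel] at h
  rw [h, add_sub_cancel_right]

/-- Two-forms commute under the wedge product. -/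
theorem wedgeTwoForms_comp_perm (β : Fin n → V [⋀^Fin 2]→L[ℝ] ℂ) (τ : Equiv.Perm (Fin n)) :
    wedgeTwoForms (fun i => β (τ i)) = wedgeTwoForms β := by
  ext v
  rw [wedgeTwoForms_apply, wedgeTwoForms_apply]
  congr 1
  -- Permuting whole blocks acts by τ on each of the two slots of a block, so its sign is sgn(τ)² =
  -- 1.
  let T : Equiv.Perm (Fin n × Fin 2) := Equiv.prodCongrLeft fun _ : Fin 2 => τ
  have hT : Equiv.Perm.sign T = 1 := by
    rw [Equiv.Perm.sign_prodCongrLeft, Fin.prod_univ_two, Int.units_mul_self]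
  refine Fintype.sum_equiv (Equiv.mulRight T⁻¹) _ _ fun s => ?_
  rw [Equiv.coe_mulRight, map_mul, map_inv, hT, inv_one, mul_one]
  congr 1
  refine Fintype.prod_equiv τ _ _ fun i => ?_
  congr 1
  funext k
  have h : T (i, k) = (τ i, k) := rfl
  have h' : T⁻¹ (T (i, k)) = (i, k) := T.symm_apply_apply _
  rw [← h, Equiv.Perm.mul_apply, h']

end WedgeAlgebra

/-! ### Top-degree forms, determinants and the complex structure. -/

section TopDegree

variable {n : ℕ}

/-- The standard frame as a real basis of `ℂⁿ`. -/
noncomputable def stdFrameBasis (n : ℕ) : Module.Basis (Fin n × Fin 2) ℝ (Cn n) :=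
  (Complex.basisOneI.smulTower (Pi.basisFun ℂ (Fin n))).reindex (Equiv.prodComm _ _)

theorem coe_stdFrameBasis (n : ℕ) : ⇑(stdFrameBasis n) = stdFrame n := by
  funext ⟨i, k⟩
  rw [stdFrameBasis, Module.Basis.reindex_apply]
  simp only [Equiv.prodComm_symm, Equiv.prodComm_apply, Prod.swap_prod_mk,
    Module.Basis.smulTower_apply, stdFrame, Pi.basisFun_apply]
  fin_cases k <;> simp [Complex.coe_basisOneI, ← Pi.single_smul]

/-- A top-degree form is determined by its value on the standard frame. -/
theorem topForm_apply_eq_det (η : Cn n [⋀^Fin n × Fin 2]→L[ℝ] ℂ) (v : Fin n × Fin 2 → Cn n) :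
    η v = (stdFrameBasis n).det v • η (stdFrame n) := by
  have h : η.toAlternatingMap =
      ((LinearMap.id : ℝ →ₗ[ℝ] ℝ).smulRight (η (stdFrame n))).compAlternatingMap
        (stdFrameBasis n).det := by
    refine (stdFrameBasis n).ext_alternating fun w hw => ?_
    let σ : Equiv.Perm (Fin n × Fin 2) := Equiv.ofBijective w (Finite.injective_iff_bijective.1 hw)
    have h0 : η.toAlternatingMap (stdFrameBasis n) = η (stdFrame n) := by
      rw [coe_stdFrameBasis]; rfl
    change η.toAlternatingMap (stdFrameBasis n ∘ σ) =
      (stdFrameBasis n).det (stdFrameBasis n ∘ σ) • η (stdFrame n)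
    rw [AlternatingMap.map_perm, AlternatingMap.map_perm, (stdFrameBasis n).det_self, h0]
    rcases Int.units_eq_one_or (Equiv.Perm.sign σ) with h | h <;> simp [h]
  exact congrArg (fun f : AlternatingMap ℝ (Cn n) ℂ (Fin n × Fin 2) => f v) h

theorem topForm_comp_stdFrame (η : Cn n [⋀^Fin n × Fin 2]→L[ℝ] ℂ) (L : Cn n →L[ℝ] Cn n) :
    η (fun p => L (stdFrame n p)) = L.det • η (stdFrame n) := by
  rw [topForm_apply_eq_det, ← coe_stdFrameBasis]
  have := (stdFrameBasis n).det_comp (L : Cn n →ₗ[ℝ] Cn n) (stdFrameBasis n)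
  rw [(stdFrameBasis n).det_self, mul_one] at this
  exact congrArg (· • η (stdFrameBasis n)) this

/-- The norm of ℂ over ℝ is z ↦ |z|². Nonnegativity of this determinant is what makes holomorphic
coordinate changes preserve orientation. -/
theorem det_restrictScalars_eq_normSq (L : Cn n →L[ℂ] Cn n) :
    (L.restrictScalars ℝ).det = Complex.normSq L.det := by
  have := LinearMap.det_restrictScalars (R := ℝ) (f := (L : Cn n →ₗ[ℂ] Cn n))
  rw [Algebra.norm_complex_apply] at this
  exact this

theorem det_mulI : (mulI n).det = 1 := by
  have : mulI n = ((Complex.I • ContinuousLinearMap.id ℂ (Cn n)).restrictScalars ℝ) := rfl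
  rw [this, det_restrictScalars_eq_normSq, ContinuousLinearMap.det]
  simp

/-- Top-degree forms are invariant under the complex structure, so a wedge product with one
`J`-anti-invariant factor and all other factors `J`-invariant vanishes. -/
theorem wedgeTwoForms_update_eq_zero (β : Fin n → Cn n [⋀^Fin 2]→L[ℝ] ℂ) (i : Fin n)
    (κ : Cn n [⋀^Fin 2]→L[ℝ] ℂ)
    (hβ : ∀ j, (β j).compContinuousLinearMap (mulI n) = β j)
    (hκ : κ.compContinuousLinearMap (mulI n) = (-1 : ℂ) • κ) :
    wedgeTwoForms (Function.update β i κ) (stdFrame n) = 0 := by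
  -- Pulling back by J multiplies the value on the frame by det J = 1; applied factor by factor, it
  -- multiplies it by -1.
  have h1 := topForm_comp_stdFrame (wedgeTwoForms (Function.update β i κ)) (mulI n)
  rw [det_mulI, one_smul] at h1
  have h2 : (wedgeTwoForms (Function.update β i κ)).compContinuousLinearMap (mulI n) =
      (-1 : ℂ) • wedgeTwoForms (Function.update β i κ) := by
    rw [wedgeTwoForms_compContinuousLinearMap, ← wedgeTwoForms_update_smul, ← hκ]
    congr 1
    funext j
    by_cases hj : j = i
    · subst hj; simp
    · simp [hj, hβ]
  have h3 := congrArg (fun f : Cn n [⋀^Fin n × Fin 2]→L[ℝ] ℂ => f (stdFrame n)) h2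
  simp only [ContinuousAlternatingMap.smul_apply, smul_eq_mul, neg_one_mul] at h3
  have h4 := h1.symm.trans h3
  exact self_eq_neg.mp h4

end TopDegree

/-! ### Integrals over open sets of functions with compact support. -/

section CompactlySupportedIntegrals

open MeasureTheory

variable {E F : Type*} [NormedAddCommGroup E] [MeasurableSpace E] [BorelSpace E]
  [NormedAddCommGroup F] {μ : Measure E} {U K : Set E}

theorem integrableOn_of_eq_zero_off_compact [IsFiniteMeasureOnCompacts μ] {g : E → F}
    (hU : IsOpen U) (hK : IsCompact K) (hKU : K ⊆ U) (hg : ContinuousOn g U)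
    (h0 : ∀ y ∈ U \ K, g y = 0) : IntegrableOn g U μ :=
  ((hg.mono hKU).integrableOn_compact hK).of_forall_sdiff_eq_zero hU.measurableSet h0

/-- The integral of a directional derivative of a compactly supported function vanishes. -/
theorem setIntegral_fderiv_eq_zero [NormedSpace ℝ E] [FiniteDimensional ℝ E] [μ.IsAddHaarMeasure] {h : E → ℂ}
    (hU : IsOpen U) (hK : IsCompact K) (hKU : K ⊆ U) (hh : ContDiffOn ℝ 1 h U)
    (h0 : ∀ y ∈ U \ K, h y = 0) (v : E) : ∫ y in U, fderiv ℝ h y v ∂μ = 0 := by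
  -- Extension by zero: smooth across the boundary of U, since h already vanishes on U outside the
  -- compact set K.
  set g : E → ℂ := U.indicator h with hgdef
  have hgU : ∀ y ∈ U, g =ᶠ[nhds y] h := fun y hy => by
    filter_upwards [hU.mem_nhds hy] with z hz
    exact Set.indicator_of_mem hz h
  have hgK : ∀ y ∉ K, g y = 0 := fun y hy => by
    by_cases hyU : y ∈ U
    · rw [hgdef, Set.indicator_of_mem hyU, h0 y ⟨hyU, hy⟩]
    · rw [hgdef, Set.indicator_of_notMem hyU]
  have hg0 : ∀ y ∉ U, g =ᶠ[nhds y] fun _ => 0 := fun y hy => by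
    filter_upwards [hK.isClosed.isOpen_compl.mem_nhds fun hyK => hy (hKU hyK)] with z hz
    exact hgK z hz
  have hg : ContDiff ℝ 1 g := contDiff_iff_contDiffAt.2 fun y => by
    by_cases hy : y ∈ U
    · exact (hh.contDiffAt (hU.mem_nhds hy)).congr_of_eventuallyEq (hgU y hy)
    · exact contDiffAt_const.congr_of_eventuallyEq (hg0 y hy)
  have hcs : HasCompactSupport g := HasCompactSupport.intro hK hgK
  have hi : Integrable (fun y => fderiv ℝ g y v) μ :=
    ((hg.continuous_fderiv one_ne_zero).clm_apply continuous_const).integrable_of_hasCompactSupport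
      (hcs.fderiv_apply ℝ v)
  -- Integration by parts against the constant function 1.
  have key : ∫ y, fderiv ℝ g y v ∂μ = 0 := by
    have := integral_mul_fderiv_eq_neg_fderiv_mul_of_integrable (μ := μ) (f := fun _ : E => (1 : ℂ))
      (g := g) (v := v) (by simp) (by simpa using hi)
      (by simpa using hg.continuous.integrable_of_hasCompactSupport hcs)
      (fun x _ => differentiableAt_const _) (fun x _ => (hg.differentiable one_ne_zero) x)
    simpa using this
  have h1 : ∫ y in U, fderiv ℝ g y v ∂μ = ∫ y, fderiv ℝ g y v ∂μ :=
    setIntegral_eq_integral_of_forall_compl_eq_zero fun y hy => by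
      rw [(hg0 y hy).fderiv_eq]
      simp
  rw [← key, ← h1]
  refine setIntegral_congr_fun hU.measurableSet fun y hy => ?_
  simp only [(hgU y hy).fderiv_eq]

end CompactlySupportedIntegrals

/-! ### Exterior derivatives of one- and two-forms in coordinates. -/

section ExteriorDerivative

variable {E : Type*} [NormedAddCommGroup E] [NormedSpace ℝ E]

/-- A 1-form as an alternating map. -/
noncomputable abbrev oneForm (σ : E →L[ℝ] ℂ) : E [⋀^Fin 1]→L[ℝ] ℂ :=
  ContinuousAlternatingMap.ofSubsingleton ℝ E ℂ (0 : Fin 1) σ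

theorem contDiffAt_oneForm {m : WithTop ℕ∞} {σ : E → E →L[ℝ] ℂ} {y : E} (h : ContDiffAt ℝ m σ y) :
    ContDiffAt ℝ m (fun z => oneForm (σ z)) y :=
  (ContinuousAlternatingMap.ofSubsingletonLIE (𝕜 := ℝ) (E := E) (F := ℂ) (0 : Fin 1)).contDiff.contDiffAt.comp y h

theorem extDeriv_oneForm_apply {σ : E → E →L[ℝ] ℂ} {y : E} (h : ContDiffAt ℝ 1 σ y)
    (w : Fin 2 → E) :
    extDeriv (fun z => oneForm (σ z)) y w =
      fderiv ℝ (fun z => σ z (w 1)) y (w 0) - fderiv ℝ (fun z => σ z (w 0)) y (w 1) := by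
  rw [extDeriv_apply ((contDiffAt_oneForm h).differentiableAt one_ne_zero), Fin.sum_univ_two]
  simp [Fin.removeNth, sub_eq_add_neg]
  rfl

theorem extDeriv_twoForm_apply {β : E → E [⋀^Fin 2]→L[ℝ] ℂ} {y : E} (h : ContDiffAt ℝ 1 β y)
    (a b c : E) :
    extDeriv β y ![a, b, c] = fderiv ℝ (fun z => β z ![b, c]) y a -
      fderiv ℝ (fun z => β z ![a, c]) y b + fderiv ℝ (fun z => β z ![a, b]) y c := by
  rw [extDeriv_apply (h.differentiableAt one_ne_zero), Fin.sum_univ_three]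
  have h0 : Fin.removeNth 0 ![a, b, c] = ![b, c] := by
    funext k; fin_cases k <;> rfl
  have h1 : Fin.removeNth 1 ![a, b, c] = ![a, c] := by
    funext k; fin_cases k <;> rfl
  have h2 : Fin.removeNth 2 ![a, b, c] = ![a, b] := by
    funext k; fin_cases k <;> rfl
  rw [h0, h1, h2]
  simp [sub_eq_add_neg]

theorem contDiffOn_form_apply {E' : Type*} [NormedAddCommGroup E'] [NormedSpace ℝ E'] {ι : Type}
    [Fintype ι] {m : WithTop ℕ∞} {β : E' → E [⋀^ι]→L[ℝ] ℂ} {U : Set E'} (h : ContDiffOn ℝ m β U)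
    (w : ι → E) : ContDiffOn ℝ m (fun z => β z w) U :=
  (ContinuousAlternatingMap.apply ℝ E ℂ w).contDiff.comp_contDiffOn h

end ExteriorDerivative

/-! ### Stokes' theorem in a chart. -/

section LocalStokes

variable {n : ℕ}

/-- Reindexing s ↦ s ∘ (p q) reverses the sign of every permutation. -/
theorem sum_perm_swap {ι V : Type*} [Fintype ι] [DecidableEq ι] {p q : ι} (hpq : p ≠ q)
    (v : ι → V) (Q Q' : (ι → V) → ℂ) (h : ∀ w, Q' w = Q (w ∘ Equiv.swap p q)) :
    ∑ s : Equiv.Perm ι, Equiv.Perm.sign s • Q' (v ∘ s) =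
      -∑ s : Equiv.Perm ι, Equiv.Perm.sign s • Q (v ∘ s) := by
  rw [← Finset.sum_neg_distrib]
  refine Fintype.sum_equiv (Equiv.mulRight (Equiv.swap p q)) _ _ fun s => ?_
  rw [h, Equiv.coe_mulRight, Equiv.Perm.sign_mul, Equiv.Perm.sign_swap hpq]
  simp [Function.comp_assoc]

theorem pair_eq {V : Type*} (w : Fin n × Fin 2 → V) (j : Fin n) :
    (fun k => w (j, k)) = ![w (j, 0), w (j, 1)] := by
  funext k; fin_cases k <;> rfl

/-- Here P stands for the factors not being differentiated. Under antisymmetrization the three terms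
of dβ, evaluated on the slots (i,0), (j,0), (j,1), contribute equally. Their total is zero because β
is closed, so each contribution vanishes. The swaps used leave P unchanged, since they avoid (i,1)
and stay in blocks i and j. -/
theorem sum_perm_mul_fderiv_eq_zero {i j : Fin n} (hij : j ≠ i) {β : Cn n → Cn n [⋀^Fin 2]→L[ℝ] ℂ}
    {y : Cn n} (hβ : ContDiffAt ℝ 1 β y) (hcl : extDeriv β y = 0) (v : Fin n × Fin 2 → Cn n)
    (P : (Fin n × Fin 2 → Cn n) → ℂ)
    (hP : ∀ w p q, p ≠ (i, 1) → q ≠ (i, 1) → (p.1 = i ∨ p.1 = j) → (q.1 = i ∨ q.1 = j) →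
      P (w ∘ Equiv.swap p q) = P w) :
    ∑ s : Equiv.Perm (Fin n × Fin 2), Equiv.Perm.sign s •
      (P (v ∘ s) * fderiv ℝ (fun z => β z ![(v ∘ s) (j, 0), (v ∘ s) (j, 1)]) y ((v ∘ s) (i, 0))) =
      0 := by
  set Q : (Fin n × Fin 2 → Cn n) → ℂ := fun w =>
    P w * fderiv ℝ (fun z => β z ![w (j, 0), w (j, 1)]) y (w (i, 0)) with hQ
  set Q₁ : (Fin n × Fin 2 → Cn n) → ℂ := fun w =>
    P w * fderiv ℝ (fun z => β z ![w (i, 0), w (j, 1)]) y (w (j, 0)) with hQ₁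
  set Q₂ : (Fin n × Fin 2 → Cn n) → ℂ := fun w =>
    P w * fderiv ℝ (fun z => β z ![w (i, 0), w (j, 0)]) y (w (j, 1)) with hQ₂
  have e1 := sum_perm_swap (p := (i, 0)) (q := (j, 0)) (by simp [hij.symm]) v Q Q₁ fun w => by
    simp only [hQ, hQ₁]
    rw [hP w _ _ (by simp) (by simp [hij]) (by simp) (by simp)]
    simp [Equiv.swap_apply_of_ne_of_ne, hij]
  have e2 := sum_perm_swap (p := (j, 0)) (q := (j, 1)) (by simp) v Q₁ Q₂ fun w => by
    simp only [hQ₁, hQ₂]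
    rw [hP w _ _ (by simp) (by simp [hij]) (by simp) (by simp)]
    simp [Equiv.swap_apply_of_ne_of_ne, hij.symm]
  have e3 : ∀ w, Q w - Q₁ w + Q₂ w = 0 := fun w => by
    have h := extDeriv_twoForm_apply hβ (w (i, 0)) (w (j, 0)) (w (j, 1))
    rw [hcl] at h
    change (0 : ℂ) = _ at h
    simp only [hQ, hQ₁, hQ₂]
    linear_combination -P w * h
  have e4 : (∑ s : Equiv.Perm (Fin n × Fin 2), Equiv.Perm.sign s • Q (v ∘ s)) -
      (∑ s : Equiv.Perm (Fin n × Fin 2), Equiv.Perm.sign s • Q₁ (v ∘ s)) +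
      ∑ s : Equiv.Perm (Fin n × Fin 2), Equiv.Perm.sign s • Q₂ (v ∘ s) = 0 := by
    rw [← Finset.sum_sub_distrib, ← Finset.sum_add_distrib]
    refine Finset.sum_eq_zero fun s _ => ?_
    rw [← smul_sub, ← smul_add, e3, smul_zero]
  change ∑ s : Equiv.Perm (Fin n × Fin 2), Equiv.Perm.sign s • Q (v ∘ s) = 0
  linear_combination (1 / 3 : ℂ) * e4 + (2 / 3 : ℂ) * e1 - (1 / 3 : ℂ) * e2

/-- The Leibniz rule `d(σ ∧ ⋀ βⱼ) = dσ ∧ ⋀ βⱼ` for closed two-forms `βⱼ`, in coordinates. -/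
theorem wedgeTwoForms_update_extDeriv_apply {β : Fin n → Cn n → Cn n [⋀^Fin 2]→L[ℝ] ℂ} {y : Cn n}
    (hβ : ∀ j, ContDiffAt ℝ 1 (β j) y) (hcl : ∀ j, extDeriv (β j) y = 0)
    {σ : Cn n → Cn n →L[ℝ] ℂ} (hσ : ContDiffAt ℝ 1 σ y) (i : Fin n) (v : Fin n × Fin 2 → Cn n) :
    wedgeTwoForms (Function.update (fun j => β j y) i (extDeriv (fun z => oneForm (σ z)) y)) v =
      ((2 : ℝ) ^ n)⁻¹ • ∑ s : Equiv.Perm (Fin n × Fin 2), Equiv.Perm.sign s • ((2 : ℂ) *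
        fderiv ℝ (fun z => σ z (v (s (i, 1))) *
          ∏ j ∈ Finset.univ.erase i, β j z ![v (s (j, 0)), v (s (j, 1))]) y (v (s (i, 0)))) := by
  rw [wedgeTwoForms_update_apply]
  congr 1
  set R : (Fin n × Fin 2 → Cn n) → ℂ := fun w =>
    ∏ j ∈ Finset.univ.erase i, β j y ![w (j, 0), w (j, 1)] with hR
  set Q : (Fin n × Fin 2 → Cn n) → ℂ := fun w =>
    fderiv ℝ (fun z => σ z (w (i, 1))) y (w (i, 0)) * R w with hQ
  set Q' : (Fin n × Fin 2 → Cn n) → ℂ := fun w =>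
    fderiv ℝ (fun z => σ z (w (i, 0))) y (w (i, 1)) * R w with hQ'
  set P : Fin n → (Fin n × Fin 2 → Cn n) → ℂ := fun j w =>
    σ y (w (i, 1)) * ∏ l ∈ (Finset.univ.erase i).erase j, β l y ![w (l, 0), w (l, 1)] with hP
  have hswap : ∀ {p q l : Fin n × Fin 2} (w : Fin n × Fin 2 → Cn n), l ≠ p → l ≠ q →
      (w ∘ Equiv.swap p q) l = w l := fun w h1 h2 => by
    simp [Equiv.swap_apply_of_ne_of_ne h1 h2]
  -- Swapping the two slots of block i identifies the two halves of dσ up to sign; this is the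
  -- origin of the factor 2.
  have e1 := sum_perm_swap (p := (i, 0)) (q := (i, 1)) (by simp) v Q Q' fun w => by
    have : R (w ∘ Equiv.swap (i, 0) (i, 1)) = R w := by
      refine Finset.prod_congr rfl fun j hj => ?_
      have hj' := Finset.ne_of_mem_erase hj
      rw [hswap w (by simp [hj']) (by simp [hj']), hswap w (by simp [hj']) (by simp [hj'])]
    simp only [hQ, hQ', this]
    simp
  -- Terms of the product rule in which the derivative falls on a closed factor β_j.
  have e2 : ∀ j ∈ Finset.univ.erase i, ∑ s : Equiv.Perm (Fin n × Fin 2), Equiv.Perm.sign s •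
      (P j (v ∘ s) *
        fderiv ℝ (fun z => β j z ![(v ∘ s) (j, 0), (v ∘ s) (j, 1)]) y ((v ∘ s) (i, 0))) = 0 := by
    intro j hj
    refine sum_perm_mul_fderiv_eq_zero (Finset.ne_of_mem_erase hj) (hβ j) (hcl j) v (P j) ?_
    intro w p q hp hq hp' hq'
    simp only [hP]
    rw [hswap w hp.symm hq.symm]
    congr 1
    refine Finset.prod_congr rfl fun l hl => ?_
    have hlj := Finset.ne_of_mem_erase hl
    have hli := Finset.ne_of_mem_erase (Finset.mem_of_mem_erase hl)
    have hl' : ∀ (k : Fin 2) (p : Fin n × Fin 2), (p.1 = i ∨ p.1 = j) → (l, k) ≠ p := by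
      rintro k p (h | h) rfl
      exacts [hli h, hlj h]
    rw [hswap w (hl' _ _ hp') (hl' _ _ hq'), hswap w (hl' _ _ hp') (hl' _ _ hq')]
  have e3 : ∀ w : Fin n × Fin 2 → Cn n,
      fderiv ℝ (fun z => σ z (w (i, 1)) *
        ∏ j ∈ Finset.univ.erase i, β j z ![w (j, 0), w (j, 1)]) y (w (i, 0)) =
      Q w + ∑ j ∈ Finset.univ.erase i,
        P j w * fderiv ℝ (fun z => β j z ![w (j, 0), w (j, 1)]) y (w (i, 0)) := by
    intro w
    have d1 : DifferentiableAt ℝ (fun z => σ z (w (i, 1))) y :=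
      (hσ.differentiableAt one_ne_zero).clm_apply (differentiableAt_const _)
    have d2 : ∀ j, DifferentiableAt ℝ (fun z => β j z ![w (j, 0), w (j, 1)]) y := fun j =>
      (ContinuousAlternatingMap.apply ℝ (Cn n) ℂ
        ![w (j, 0), w (j, 1)]).differentiableAt.comp y ((hβ j).differentiableAt one_ne_zero)
    have d3 := HasFDerivAt.finsetProd (u := Finset.univ.erase i) (x := y)
      fun j _ => (d2 j).hasFDerivAt
    rw [(d1.hasFDerivAt.fun_mul d3).fderiv]
    simp only [add_apply, smul_apply,
      sum_apply, smul_eq_mul, hQ, hP, hR, Finset.mul_sum, mul_assoc]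
    ring
  calc _ = ∑ s : Equiv.Perm (Fin n × Fin 2), Equiv.Perm.sign s • (Q (v ∘ s) - Q' (v ∘ s)) := by
        refine Finset.sum_congr rfl fun s _ => ?_
        rw [extDeriv_oneForm_apply hσ]
        simp only [hQ, hQ', hR, sub_mul, Function.comp_apply]
        congr 3
        all_goals
          refine Finset.prod_congr rfl fun j _ => ?_
          rw [← pair_eq (fun p => v (s p)) j]
    _ = 2 * ∑ s : Equiv.Perm (Fin n × Fin 2), Equiv.Perm.sign s • Q (v ∘ s) := by
        simp only [smul_sub, Finset.sum_sub_distrib]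
        linear_combination -e1
    _ = 2 * (∑ s : Equiv.Perm (Fin n × Fin 2), Equiv.Perm.sign s • Q (v ∘ s) +
          ∑ j ∈ Finset.univ.erase i, ∑ s : Equiv.Perm (Fin n × Fin 2), Equiv.Perm.sign s •
            (P j (v ∘ s) *
              fderiv ℝ (fun z => β j z ![(v ∘ s) (j, 0), (v ∘ s) (j, 1)]) y
                ((v ∘ s) (i, 0)))) := by
        rw [Finset.sum_eq_zero e2, add_zero]
    _ = _ := by
        rw [Finset.sum_comm, ← Finset.sum_add_distrib, Finset.mul_sum]
        refine Finset.sum_congr rfl fun s _ => ?_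
        rw [← Finset.smul_sum, ← smul_add, ← e3 (v ∘ s), mul_smul_comm]
        rfl

/-- By the Leibniz rule the integrand is a finite combination of derivatives, in constant
directions, of functions σ(v) ∏ βⱼ. These vanish off K together with σ, so each derivative
integrates to zero. -/
theorem setIntegral_wedge_extDeriv_eq_zero {U K : Set (Cn n)} (hU : IsOpen U) (hK : IsCompact K)
    (hKU : K ⊆ U) {β : Fin n → Cn n → Cn n [⋀^Fin 2]→L[ℝ] ℂ}
    (hβ : ∀ j, ContDiffOn ℝ ∞ (β j) U) (hcl : ∀ j, ∀ y ∈ U, extDeriv (β j) y = 0)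
    {σ : Cn n → Cn n →L[ℝ] ℂ} (hσ : ContDiffOn ℝ ∞ σ U) (h0 : ∀ y ∈ U \ K, σ y = 0) (i : Fin n)
    (v : Fin n × Fin 2 → Cn n) :
    ∫ y in U, wedgeTwoForms
      (Function.update (fun j => β j y) i (extDeriv (fun z => oneForm (σ z)) y)) v = 0 := by
  have hF : ∀ s : Equiv.Perm (Fin n × Fin 2), ContDiffOn ℝ ∞ (fun z => σ z (v (s (i, 1))) *
      ∏ j ∈ Finset.univ.erase i, β j z ![v (s (j, 0)), v (s (j, 1))]) U := fun s =>
    (hσ.clm_apply contDiffOn_const).mul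
      (contDiffOn_prod fun j _ => contDiffOn_form_apply (hβ j) _)
  have hF0 : ∀ s : Equiv.Perm (Fin n × Fin 2), ∀ y ∈ U \ K, σ y (v (s (i, 1))) *
      ∏ j ∈ Finset.univ.erase i, β j y ![v (s (j, 0)), v (s (j, 1))] = 0 := fun s y hy => by
    rw [h0 y hy, zero_apply, zero_mul]
  have hint : ∀ s : Equiv.Perm (Fin n × Fin 2), MeasureTheory.IntegrableOn (fun y =>
      Equiv.Perm.sign s • ((2 : ℂ) * fderiv ℝ (fun z => σ z (v (s (i, 1))) *
        ∏ j ∈ Finset.univ.erase i, β j z ![v (s (j, 0)), v (s (j, 1))]) y (v (s (i, 0))))) U := by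
    intro s
    refine integrableOn_of_eq_zero_off_compact hU hK hKU ?_ ?_
    · refine ContinuousOn.const_smul (continuousOn_const.mul ?_) _
      exact (((hF s).fderiv_of_isOpen (m := ∞) hU le_rfl).clm_apply contDiffOn_const).continuousOn
    · intro y hy
      have : (fun z => σ z (v (s (i, 1))) *
          ∏ j ∈ Finset.univ.erase i, β j z ![v (s (j, 0)), v (s (j, 1))]) =ᶠ[nhds y]
            fun _ => (0 : ℂ) := by
        filter_upwards [(hU.sdiff hK.isClosed).mem_nhds hy] with z hz using hF0 s z hz
      rw [this.fderiv_eq]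
      simp
  rw [MeasureTheory.setIntegral_congr_fun hU.measurableSet fun y hy =>
    wedgeTwoForms_update_extDeriv_apply
      (fun j => ((hβ j).contDiffAt (hU.mem_nhds hy)).of_le (by simp)) (fun j => hcl j y hy)
      ((hσ.contDiffAt (hU.mem_nhds hy)).of_le (by simp)) i v]
  rw [MeasureTheory.integral_smul, MeasureTheory.integral_finsetSum _ fun s _ => hint s,
    Finset.sum_eq_zero, smul_zero]
  intro s _
  simp only [Units.smul_def, zsmul_eq_mul]
  rw [MeasureTheory.integral_const_mul, MeasureTheory.integral_const_mul,
    setIntegral_fderiv_eq_zero hU hK hKU ((hF s).of_le (by simp)) (hF0 s), mul_zero, mul_zero]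

end LocalStokes

/-! ### The operator ∂∂̄ on ℂⁿ and its symmetry. -/

section Deldbar

variable {n : ℕ}

theorem two_le_infty : (2 : WithTop ℕ∞) ≤ ∞ := by
  exact WithTop.coe_le_coe.2 (le_top : (2 : ℕ∞) ≤ ⊤)

theorem mulI_mulI (v : Cn n) : mulI n (mulI n v) = -v := by
  funext i
  simp [mulI, ← mul_assoc]

theorem contDiffOn_fderiv_apply {E : Type*} [NormedAddCommGroup E] [NormedSpace ℝ E] {U : Set E}
    (hU : IsOpen U) {f : E → ℂ} (hf : ContDiffOn ℝ ∞ f U) (v : E) :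
    ContDiffOn ℝ ∞ (fun y => fderiv ℝ f y v) U :=
  (hf.fderiv_of_isOpen (m := ∞) hU le_rfl).clm_apply contDiffOn_const

theorem fderiv_fderiv_comm {E : Type*} [NormedAddCommGroup E] [NormedSpace ℝ E] {f : E → ℂ} {y : E}
    (hf : ContDiffAt ℝ 2 f y) (u v : E) :
    fderiv ℝ (fun z => fderiv ℝ f z u) y v = fderiv ℝ (fun z => fderiv ℝ f z v) y u := by
  have hd : DifferentiableAt ℝ (fderiv ℝ f) y :=
    (hf.fderiv_right (m := 1) (by norm_num)).differentiableAt one_ne_zero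
  have h : ∀ w, fderiv ℝ (fun z => fderiv ℝ f z w) y = (fderiv ℝ (fderiv ℝ f) y).flip w := by
    intro w
    rw [fderiv_clm_apply hd (differentiableAt_const w)]
    simp
  rw [h, h]
  exact (hf.isSymmSndFDerivAt (by simp)) v u

theorem contDiffAt_dbar {m m' : WithTop ℕ∞} {f : Cn n → ℂ} {y : Cn n} (hf : ContDiffAt ℝ m' f y)
    (h : m + 1 ≤ m') : ContDiffAt ℝ m (dbar f) y := by
  have h1 : ContDiffAt ℝ m (fderiv ℝ f) y := hf.fderiv_right h
  have h2 : ContDiffAt ℝ m (fun z => (fderiv ℝ f z).comp (mulI n)) y :=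
    h1.clm_comp contDiffAt_const
  exact (h1.add (h2.const_smul Complex.I)).const_smul (1 / 2 : ℂ)

theorem contDiffOn_deldbar {f : Cn n → ℂ} {U : Set (Cn n)} (hU : IsOpen U)
    (hf : ContDiffOn ℝ ∞ f U) : ContDiffOn ℝ ∞ (deldbar f) U := by
  intro y hy
  have h1 : ContDiffAt ℝ ∞ (fun z => oneForm (dbar f z)) y :=
    contDiffAt_oneForm (contDiffAt_dbar (hf.contDiffAt (hU.mem_nhds hy)) (by simp))
  have h2 := h1.fderiv_right (m := ∞) (by simp)
  exact ((ContinuousAlternatingMap.alternatizeUncurryFinCLM ℝ (Cn n) ℂ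
    (n := 1)).contDiff.contDiffAt.comp y h2).contDiffWithinAt

theorem extDeriv_deldbar {f : Cn n → ℂ} {y : Cn n} (hf : ContDiffAt ℝ ∞ f y) :
    extDeriv (deldbar f) y = 0 :=
  extDeriv_extDeriv_apply (r := ∞) (contDiffAt_oneForm (contDiffAt_dbar hf (by simp)))
    (by simpa using two_le_infty)

theorem deldbar_congr {f g : Cn n → ℂ} {y : Cn n} (h : f =ᶠ[nhds y] g) :
    deldbar f y = deldbar g y := by
  refine Filter.EventuallyEq.extDeriv_eq ?_
  filter_upwards [h.eventuallyEq_nhds] with z hz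
  rw [dbar, dbar, hz.fderiv_eq]

/-- Since ∂̄f = (df + √-1 df ∘ J)/2 and d(df) = 0, only (√-1/2) d(df ∘ J) survives. -/
theorem deldbar_apply {f : Cn n → ℂ} {y : Cn n} (hf : ContDiffAt ℝ 2 f y) (w : Fin 2 → Cn n) :
    deldbar f y w = (Complex.I / 2) *
      (fderiv ℝ (fun z => fderiv ℝ f z (mulI n (w 1))) y (w 0) -
        fderiv ℝ (fun z => fderiv ℝ f z (mulI n (w 0))) y (w 1)) := by
  have hd : DifferentiableAt ℝ (fderiv ℝ f) y :=
    (hf.fderiv_right (m := 1) (by norm_num)).differentiableAt one_ne_zero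
  have hd' : ∀ w, DifferentiableAt ℝ (fun z => fderiv ℝ f z w) y := fun w =>
    hd.clm_apply (differentiableAt_const w)
  have h : ∀ a b, fderiv ℝ (fun z => dbar f z a) y b = (1 / 2 : ℂ) *
      (fderiv ℝ (fun z => fderiv ℝ f z a) y b +
        Complex.I * fderiv ℝ (fun z => fderiv ℝ f z (mulI n a)) y b) := by
    intro a b
    have e : (fun z => dbar f z a) = fun z => (1 / 2 : ℂ) *
      (fderiv ℝ f z a + Complex.I * fderiv ℝ f z (mulI n a)) := rfl
    rw [e, fderiv_const_mul ((hd' _).fun_add ((hd' _).const_mul _)),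
      fderiv_fun_add (hd' _) ((hd' _).const_mul _), fderiv_const_mul (hd' _)]
    rfl
  have := extDeriv_oneForm_apply (contDiffAt_dbar (m := 1) hf (by norm_num)) w
  rw [h, h, fderiv_fderiv_comm hf (w 1) (w 0)] at this
  change extDeriv (fun z => oneForm (dbar f z)) y w = _
  rw [this]
  ring

/-- J² = -1 and the symmetry of the Hessian exchange the two terms of `deldbar_apply`. -/
theorem deldbar_comp_mulI {f : Cn n → ℂ} {y : Cn n} (hf : ContDiffAt ℝ 2 f y) :
    (deldbar f y).compContinuousLinearMap (mulI n) = deldbar f y := by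
  ext w
  have h := deldbar_apply hf fun k => mulI n (w k)
  simp only [mulI_mulI, map_neg, fderiv_fun_neg, neg_apply] at h
  have e : (deldbar f y).compContinuousLinearMap (mulI n) w = deldbar f y fun k => mulI n (w k) :=
    rfl
  rw [e, h, deldbar_apply hf, fderiv_fderiv_comm hf (w 1), fderiv_fderiv_comm hf (w 0)]
  ring

/-- `√-1/2 (f dᶜg - g dᶜf)`, with `dᶜg = dg ∘ J`: a primitive of `f ∂∂̄g - g ∂∂̄f` up to
`J`-anti-invariant forms. -/
noncomputable def dcCommutator (f g : Cn n → ℂ) (y : Cn n) : Cn n →L[ℝ] ℂ :=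
  (Complex.I / 2) • (f y • (fderiv ℝ g y).comp (mulI n) - g y • (fderiv ℝ f y).comp (mulI n))

theorem contDiffOn_dcCommutator {f g : Cn n → ℂ} {U : Set (Cn n)} (hU : IsOpen U)
    (hf : ContDiffOn ℝ ∞ f U) (hg : ContDiffOn ℝ ∞ g U) :
    ContDiffOn ℝ ∞ (dcCommutator f g) U :=
  have h : ∀ {g : Cn n → ℂ}, ContDiffOn ℝ ∞ g U →
      ContDiffOn ℝ ∞ (fun y => (fderiv ℝ g y).comp (mulI n)) U := fun hg =>
    (hg.fderiv_of_isOpen (m := ∞) hU le_rfl).clm_comp contDiffOn_const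
  ((hf.smul (h hg)).sub (hg.smul (h hf))).const_smul (Complex.I / 2)

/-- The Hessian terms cancel against those of d(`dcCommutator`), leaving -(√-1/2)(df ∧ dᶜg - dg ∧
dᶜf). Pull-back by J sends df to dᶜf and dᶜg to -dg, hence exchanges the two products. -/
theorem deldbar_commutator {f g : Cn n → ℂ} {y : Cn n} (hf : ContDiffAt ℝ 2 f y)
    (hg : ContDiffAt ℝ 2 g y) :
    (f y • deldbar g y - g y • deldbar f y -
        extDeriv (fun z => oneForm (dcCommutator f g z)) y).compContinuousLinearMap (mulI n) =
      (-1 : ℂ) • (f y • deldbar g y - g y • deldbar f y -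
        extDeriv (fun z => oneForm (dcCommutator f g z)) y) := by
  have hd : ∀ {f : Cn n → ℂ}, ContDiffAt ℝ 2 f y → ∀ w,
      DifferentiableAt ℝ (fun z => fderiv ℝ f z w) y := fun hf w =>
    ((hf.fderiv_right (m := 1) (by norm_num)).differentiableAt one_ne_zero).clm_apply
      (differentiableAt_const w)
  have hσ : ContDiffAt ℝ 1 (dcCommutator f g) y := by
    have h : ∀ {g : Cn n → ℂ}, ContDiffAt ℝ 2 g y →
        ContDiffAt ℝ 1 (fun y => (fderiv ℝ g y).comp (mulI n)) y := fun hg =>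
      (hg.fderiv_right (m := 1) (by norm_num)).clm_comp contDiffAt_const
    exact (((hf.of_le (by norm_num)).smul (h hg)).sub
      ((hg.of_le (by norm_num)).smul (h hf))).const_smul (Complex.I / 2)
  have hdf := hf.differentiableAt two_ne_zero
  have hdg := hg.differentiableAt two_ne_zero
  have h1 : ∀ a b, fderiv ℝ (fun z => dcCommutator f g z a) y b = (Complex.I / 2) *
      (f y * fderiv ℝ (fun z => fderiv ℝ g z (mulI n a)) y b + fderiv ℝ f y b * fderiv ℝ g y (mulI n a)
        - (g y * fderiv ℝ (fun z => fderiv ℝ f z (mulI n a)) y b +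
          fderiv ℝ g y b * fderiv ℝ f y (mulI n a))) := by
    intro a b
    have e : (fun z => dcCommutator f g z a) = fun z => (Complex.I / 2) *
      (f z * fderiv ℝ g z (mulI n a) - g z * fderiv ℝ f z (mulI n a)) := rfl
    rw [e, fderiv_const_mul ((hdf.fun_mul (hd hg _)).fun_sub (hdg.fun_mul (hd hf _))),
      fderiv_fun_sub (hdf.fun_mul (hd hg _)) (hdg.fun_mul (hd hf _)),
      fderiv_fun_mul hdf (hd hg _), fderiv_fun_mul hdg (hd hf _)]
    simp only [smul_apply, sub_apply, add_apply, smul_eq_mul]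
    ring
  have h2 : ∀ w : Fin 2 → Cn n, (f y • deldbar g y - g y • deldbar f y -
      extDeriv (fun z => oneForm (dcCommutator f g z)) y) w = (-Complex.I / 2) *
      (fderiv ℝ f y (w 0) * fderiv ℝ g y (mulI n (w 1)) -
        fderiv ℝ g y (w 0) * fderiv ℝ f y (mulI n (w 1)) -
        fderiv ℝ f y (w 1) * fderiv ℝ g y (mulI n (w 0)) +
        fderiv ℝ g y (w 1) * fderiv ℝ f y (mulI n (w 0))) := by
    intro w
    rw [ContinuousAlternatingMap.sub_apply, ContinuousAlternatingMap.sub_apply,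
      ContinuousAlternatingMap.smul_apply, ContinuousAlternatingMap.smul_apply,
      extDeriv_oneForm_apply hσ, deldbar_apply hf, deldbar_apply hg, h1, h1]
    simp only [smul_eq_mul]
    ring
  ext w
  rw [ContinuousAlternatingMap.compContinuousLinearMap_apply, ContinuousAlternatingMap.smul_apply,
    h2, h2]
  simp only [Function.comp_apply, mulI_mulI, map_neg, smul_eq_mul]
  ring

/-- Local self-adjointness of `∂∂̄` against closed `(1,1)`-forms. -/
theorem setIntegral_wedge_deldbar_comm {U K : Set (Cn n)} (hU : IsOpen U) (hK : IsCompact K)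
    (hKU : K ⊆ U) {β : Fin n → Cn n → Cn n [⋀^Fin 2]→L[ℝ] ℂ}
    (hβ : ∀ j, ContDiffOn ℝ ∞ (β j) U) (hcl : ∀ j, ∀ y ∈ U, extDeriv (β j) y = 0)
    (hJ : ∀ j, ∀ y ∈ U, (β j y).compContinuousLinearMap (mulI n) = β j y)
    {f g : Cn n → ℂ} (hf : ContDiffOn ℝ ∞ f U) (hg : ContDiffOn ℝ ∞ g U)
    (h0 : ∀ y ∈ U \ K, f y = 0) (i : Fin n) :
    ∫ y in U, (f y * wedgeTwoForms (Function.update (fun j => β j y) i (deldbar g y)) (stdFrame n) -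
      g y * wedgeTwoForms (Function.update (fun j => β j y) i (deldbar f y)) (stdFrame n)) = 0 := by
  -- Each term of σ contains f or df, and f vanishes on the open set U \ K; no support condition on
  -- g is needed.
  have hσ0 : ∀ y ∈ U \ K, dcCommutator f g y = 0 := fun y hy => by
    have : f =ᶠ[nhds y] fun _ => (0 : ℂ) := by
      filter_upwards [(hU.sdiff hK.isClosed).mem_nhds hy] with z hz using h0 z hz
    rw [dcCommutator, this.fderiv_eq, h0 y hy]
    ext w
    simp
  rw [← setIntegral_wedge_extDeriv_eq_zero hU hK hKU hβ hcl (contDiffOn_dcCommutator hU hf hg) hσ0 i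
    (stdFrame n)]
  refine MeasureTheory.setIntegral_congr_fun hU.measurableSet fun y hy => ?_
  have hfy : ContDiffAt ℝ 2 f y := (hf.contDiffAt (hU.mem_nhds hy)).of_le two_le_infty
  have hgy : ContDiffAt ℝ 2 g y := (hg.contDiffAt (hU.mem_nhds hy)).of_le two_le_infty
  have h := wedgeTwoForms_update_eq_zero (fun j => β j y) i _ (fun j => hJ j y hy)
    (deldbar_commutator hfy hgy)
  rw [wedgeTwoForms_update_sub, wedgeTwoForms_update_sub, wedgeTwoForms_update_smul,
    wedgeTwoForms_update_smul] at h
  exact sub_eq_zero.mp h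

/-- `∂∂̄` commutes with pull-back by holomorphic maps. -/
theorem deldbar_comp_holomorphic {f : Cn n → ℂ} {h : Cn n → Cn n} {y : Cn n}
    (hf : ContDiffAt ℝ ∞ f (h y)) (hh : ContDiffAt ℝ ∞ h y)
    (hJ : ∀ᶠ z in nhds y, ∀ v, fderiv ℝ h z (mulI n v) = mulI n (fderiv ℝ h z v)) :
    deldbar (fun z => f (h z)) y = (deldbar f (h y)).compContinuousLinearMap (fderiv ℝ h y) := by
  have h1 : ContDiffAt ℝ ∞ (fun z => oneForm (dbar f z)) (h y) :=
    contDiffAt_oneForm (contDiffAt_dbar hf (by simp))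
  -- As ∂∂̄ = d∂̄, naturality of d reduces the claim to ∂̄(f ∘ h) = h*∂̄f near y, which is the chain
  -- rule together with dh ∘ J = J ∘ dh.
  rw [deldbar, deldbar, ← extDeriv_pullback (r := ∞) (h1.differentiableAt (by simp)) hh
    (by simpa using two_le_infty)]
  refine Filter.EventuallyEq.extDeriv_eq ?_
  have hfe : ∀ᶠ z in nhds y, ContDiffAt ℝ 1 f (h z) :=
    hh.continuousAt.eventually ((hf.of_le (by simp)).eventually (by simp))
  have hhe : ∀ᶠ z in nhds y, ContDiffAt ℝ 1 h z := (hh.of_le (by simp)).eventually (by simp)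
  filter_upwards [hJ, hfe, hhe] with z hz hfz hhz
  ext w
  have hc : fderiv ℝ (fun z => f (h z)) z = (fderiv ℝ f (h z)).comp (fderiv ℝ h z) :=
    fderiv_comp z (hfz.differentiableAt one_ne_zero) (hhz.differentiableAt one_ne_zero)
  have hz' := hz (w 0)
  simp [dbar, hc, hz']

end Deldbar

/-! ### Forms in holomorphic charts and transition maps. -/

section Charts

variable {n : ℕ} {X : Type*} [TopologicalSpace X]

theorem fderiv_restrictScalars_mulI {h : Cn n → Cn n} {y : Cn n} (hh : DifferentiableAt ℂ h y)
    (v : Cn n) : fderiv ℝ h y (mulI n v) = mulI n (fderiv ℝ h y v) := by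
  rw [hh.fderiv_restrictScalars ℝ]
  exact map_smul (fderiv ℂ h y) Complex.I v

/-- The domain, in the chart `e`, of the transition map to the chart `e'`. -/
def transitionDomain (e e' : OpenPartialHomeomorph X (Cn n)) : Set (Cn n) :=
  e.target ∩ e.symm ⁻¹' e'.source

theorem isOpen_transitionDomain (e e' : OpenPartialHomeomorph X (Cn n)) :
    IsOpen (transitionDomain e e') :=
  e.isOpen_inter_preimage_symm e'.open_source

theorem extDeriv_const_smul {E : Type*} [NormedAddCommGroup E] [NormedSpace ℝ E] {k : ℕ} (a : ℂ)
    {β : E → E [⋀^Fin k]→L[ℝ] ℂ} {y : E} (h : DifferentiableAt ℝ β y) :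
    extDeriv (fun z => a • β z) y = a • extDeriv β y := by
  rw [extDeriv, fderiv_fun_const_smul h, ContinuousAlternatingMap.alternatizeUncurryFin_smul,
    extDeriv]

variable [ChartedSpace (Cn n) X]

theorem mem_transitionDomain_chartAt {e : OpenPartialHomeomorph X (Cn n)} {y : Cn n}
    (hy : y ∈ e.target) : y ∈ transitionDomain e (chartAt (Cn n) (e.symm y)) :=
  ⟨hy, mem_chart_source _ _⟩

/-- The expression of a function in a chart, as a complex-valued function. -/
noncomputable def localRep (φ : SmoothFn n X) (e : OpenPartialHomeomorph X (Cn n)) (z : Cn n) : ℂ :=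
  ((φ (e.symm z) : ℝ) : ℂ)

theorem iDeldbar_apply (φ : SmoothFn n X) (x : X) :
    iDeldbar φ x = Complex.I • deldbar (localRep φ (chartAt (Cn n) x)) (chartAt (Cn n) x x) :=
  rfl

/-- Smooth closed complex-valued forms of type `(1,1)`. -/
structure IsClosedOneOne (β : TwoForm n X) : Prop where
  smooth : TwoForm.IsSmooth β
  closed : TwoForm.IsClosed β
  oneOne : TwoForm.IsOneOne β

theorem IsClosedRealOneOne.isClosedOneOne {β : TwoForm n X} (h : IsClosedRealOneOne β) :
    IsClosedOneOne β :=
  ⟨h.smooth, h.closed, h.oneOne⟩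

theorem IsClosedOneOne.add_smul {β β' : TwoForm n X} (h : IsClosedOneOne β)
    (h' : IsClosedOneOne β') (a : ℂ) : IsClosedOneOne (fun x => β x + a • β' x) where
  smooth e he := (h.smooth e he).add ((h'.smooth e he).const_smul a)
  closed e he y hy := by
    have d1 := ((h.smooth e he).contDiffAt (e.open_target.mem_nhds hy)).differentiableAt
      (by simp)
    have d2 := ((h'.smooth e he).contDiffAt (e.open_target.mem_nhds hy)).differentiableAt
      (by simp)
    change extDeriv (fun z => DiffForm.inChart β e z + a • DiffForm.inChart β' e z) y = 0
    rw [extDeriv_fun_add d1 (d2.fun_const_smul a), extDeriv_const_smul a d2, h.closed e he y hy,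
      h'.closed e he y hy, smul_zero, add_zero]
  oneOne x u v := by
    have e1 := h.oneOne x u v
    have e2 := h'.oneOne x u v
    simp only [ContinuousAlternatingMap.add_apply, ContinuousAlternatingMap.smul_apply, e1, e2]

variable [IsManifold 𝓘(ℂ, Cn n) ω X]

theorem contDiffAt_complex_transition {e e' : OpenPartialHomeomorph X (Cn n)}
    (he : e ∈ atlas (Cn n) X) (he' : e' ∈ atlas (Cn n) X) {y : Cn n}
    (hy : y ∈ transitionDomain e e') : ContDiffAt ℂ ω (fun z => e' (e.symm z)) y := by
  have h := (contDiffGroupoid ω 𝓘(ℂ, Cn n)).compatible he he'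
  rw [contDiffGroupoid, mem_groupoid_of_pregroupoid] at h
  have h1 : ContDiffOn ℂ ω (fun z => e' (e.symm z)) (transitionDomain e e') := by
    have := h.1
    simpa [contDiffPregroupoid, transitionDomain, Function.comp_def] using this
  exact h1.contDiffAt ((isOpen_transitionDomain e e').mem_nhds hy)

theorem contDiffAt_transition {e e' : OpenPartialHomeomorph X (Cn n)}
    (he : e ∈ atlas (Cn n) X) (he' : e' ∈ atlas (Cn n) X) {y : Cn n}
    (hy : y ∈ transitionDomain e e') : ContDiffAt ℝ ∞ (fun z => e' (e.symm z)) y :=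
  ((contDiffAt_complex_transition he he' hy).restrict_scalars ℝ).of_le le_top

theorem fderiv_transition_mulI {e e' : OpenPartialHomeomorph X (Cn n)}
    (he : e ∈ atlas (Cn n) X) (he' : e' ∈ atlas (Cn n) X) {y : Cn n}
    (hy : y ∈ transitionDomain e e') (v : Cn n) :
    fderiv ℝ (fun z => e' (e.symm z)) y (mulI n v) =
      mulI n (fderiv ℝ (fun z => e' (e.symm z)) y v) :=
  fderiv_restrictScalars_mulI
    ((contDiffAt_complex_transition he he' hy).differentiableAt (by simp)) v

/-- The tangent space at x is ℂⁿ through the preferred chart at x, so differentiating `e.symm` means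
differentiating the transition into the preferred chart at the image point, which varies with y. -/
theorem mfderiv_chart_symm {e : OpenPartialHomeomorph X (Cn n)} (he : e ∈ atlas (Cn n) X)
    {y : Cn n} (hy : y ∈ e.target) :
    (mfderiv 𝓘(ℝ, Cn n) 𝓘(ℝ, Cn n) e.symm y : Cn n →L[ℝ] Cn n) =
      fderiv ℝ (fun z => chartAt (Cn n) (e.symm y) (e.symm z)) y := by
  have : IsManifold 𝓘(ℝ, Cn n) ∞ X := isManifold_real_of_complex n X
  have : IsManifold 𝓘(ℝ, Cn n) 1 X := IsManifold.of_le (n := ∞) (by simp)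
  have hd : MDifferentiableAt 𝓘(ℝ, Cn n) 𝓘(ℝ, Cn n) e.symm y := mdifferentiableAt_atlas_symm he hy
  refine hd.mfderiv.trans ?_
  simp [writtenInExtChartAt, extChartAt, Function.comp_def, chartAt_self_eq]
  rfl

theorem inChart_apply {ι : Type} (β : DiffForm n X ι) {e : OpenPartialHomeomorph X (Cn n)}
    (he : e ∈ atlas (Cn n) X) {y : Cn n} (hy : y ∈ e.target) (w : ι → Cn n) :
    DiffForm.inChart β e y w = β (e.symm y) fun k =>
      fderiv ℝ (fun z => chartAt (Cn n) (e.symm y) (e.symm z)) y (w k) := by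
  rw [← mfderiv_chart_symm he hy]
  rfl

/-- Chain rule for the passage from e to the preferred chart at the point through e'. -/
theorem inChart_transition {ι : Type} (β : DiffForm n X ι) {e e' : OpenPartialHomeomorph X (Cn n)}
    (he : e ∈ atlas (Cn n) X) (he' : e' ∈ atlas (Cn n) X) {y : Cn n}
    (hy : y ∈ transitionDomain e e') :
    DiffForm.inChart β e y = (DiffForm.inChart β e' (e' (e.symm y))).compContinuousLinearMap
      (fderiv ℝ (fun z => e' (e.symm z)) y) := by
  ext w
  rw [ContinuousAlternatingMap.compContinuousLinearMap_apply, inChart_apply β he hy.1,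
    inChart_apply β he' (e'.map_source hy.2), e'.left_inv hy.2]
  congr 1
  funext k
  have h1 : (fun z => chartAt (Cn n) (e.symm y) (e.symm z)) =ᶠ[nhds y]
      fun z => (fun x => chartAt (Cn n) (e.symm y) (e'.symm x)) (e' (e.symm z)) := by
    filter_upwards [(isOpen_transitionDomain e e').mem_nhds hy] with z hz
    simp only [e'.left_inv hz.2]
  have hmem : e' (e.symm y) ∈ transitionDomain e' (chartAt (Cn n) (e.symm y)) := by
    refine ⟨e'.map_source hy.2, ?_⟩
    rw [Set.mem_preimage, e'.left_inv hy.2]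
    exact mem_chart_source _ _
  rw [h1.fderiv_eq, fderiv_fun_comp (g := fun x => chartAt (Cn n) (e.symm y) (e'.symm x)) y
    ((contDiffAt_transition he' (chart_mem_atlas _ _) hmem).differentiableAt (by simp))
    ((contDiffAt_transition he he' hy).differentiableAt (by simp))]
  rfl

/-- The transition to the preferred chart is holomorphic, so its differential intertwines
multiplication by √-1 with J. -/
theorem inChart_comp_mulI {β : TwoForm n X} (hβ : TwoForm.IsOneOne β)
    {e : OpenPartialHomeomorph X (Cn n)} (he : e ∈ atlas (Cn n) X) {y : Cn n} (hy : y ∈ e.target) :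
    (DiffForm.inChart β e y).compContinuousLinearMap (mulI n) = DiffForm.inChart β e y := by
  ext w
  rw [ContinuousAlternatingMap.compContinuousLinearMap_apply, inChart_apply β he hy,
    inChart_apply β he hy]
  set D := fderiv ℝ (fun z => chartAt (Cn n) (e.symm y) (e.symm z)) y with hD
  have h1 : (fun k => D ((⇑(mulI n) ∘ w) k)) = ![mulI n (D (w 0)), mulI n (D (w 1))] := by
    funext k
    fin_cases k <;>
      exact fderiv_transition_mulI he (chart_mem_atlas _ _) (mem_transitionDomain_chartAt hy) _
  have h2 : (fun k => D (w k)) = ![D (w 0), D (w 1)] := by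
    funext k; fin_cases k <;> rfl
  rw [h1, h2]
  exact hβ (e.symm y) (D (w 0)) (D (w 1))

theorem contDiffOn_localRep (φ : SmoothFn n X) {e : OpenPartialHomeomorph X (Cn n)}
    (he : e ∈ atlas (Cn n) X) : ContDiffOn ℝ ∞ (localRep φ e) e.target := by
  have : IsManifold 𝓘(ℝ, Cn n) ∞ X := isManifold_real_of_complex n X
  have h := contMDiffOn_symm_of_mem_maximalAtlas (I := 𝓘(ℝ, Cn n)) (n := ∞)
    (IsManifold.subset_maximalAtlas he)
  have h1 : ContDiffOn ℝ ∞ (fun z => φ (e.symm z)) e.target :=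
    contMDiffOn_iff_contDiffOn.1 (φ.contMDiff.comp_contMDiffOn h)
  exact Complex.ofRealCLM.contDiff.comp_contDiffOn h1

/-- `iDeldbar` is defined pointwise, in a chart depending on the point. Holomorphic invariance of
∂∂̄ gives a single formula on each whole chart, from which smoothness and closedness can be read. -/
theorem inChart_iDeldbar (φ : SmoothFn n X) {e : OpenPartialHomeomorph X (Cn n)}
    (he : e ∈ atlas (Cn n) X) {y : Cn n} (hy : y ∈ e.target) :
    DiffForm.inChart (iDeldbar φ) e y = Complex.I • deldbar (localRep φ e) y := by
  set e' := chartAt (Cn n) (e.symm y) with he'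
  have hmem : y ∈ transitionDomain e e' := mem_transitionDomain_chartAt hy
  have h1 : localRep φ e =ᶠ[nhds y] fun z => localRep φ e' (e' (e.symm z)) := by
    filter_upwards [(isOpen_transitionDomain e e').mem_nhds hmem] with z hz
    simp only [localRep, e'.left_inv hz.2]
  rw [deldbar_congr h1, deldbar_comp_holomorphic
    ((contDiffOn_localRep φ (chart_mem_atlas _ _)).contDiffAt
      (e'.open_target.mem_nhds (e'.map_source hmem.2)))
    (contDiffAt_transition he (chart_mem_atlas _ _) hmem)
    (by
      filter_upwards [(isOpen_transitionDomain e e').mem_nhds hmem] with z hz v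
      exact fderiv_transition_mulI he (chart_mem_atlas _ _) hz v)]
  ext w
  rw [inChart_apply _ he hy]
  rfl

theorem isClosedOneOne_iDeldbar (φ : SmoothFn n X) : IsClosedOneOne (iDeldbar φ) where
  smooth e he :=
    ((contDiffOn_deldbar e.open_target (contDiffOn_localRep φ he)).const_smul Complex.I).congr
      fun _ hy => inChart_iDeldbar φ he hy
  closed e he y hy := by
    have h : DiffForm.inChart (iDeldbar φ) e =ᶠ[nhds y] fun z =>
        Complex.I • deldbar (localRep φ e) z := by
      filter_upwards [e.open_target.mem_nhds hy] with z hz using inChart_iDeldbar φ he hz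
    have hc := (contDiffOn_localRep φ he).contDiffAt (e.open_target.mem_nhds hy)
    have hd := ((contDiffOn_deldbar e.open_target (contDiffOn_localRep φ he)).contDiffAt
      (e.open_target.mem_nhds hy)).differentiableAt (by simp)
    rw [h.extDeriv_eq, extDeriv_const_smul _ hd, extDeriv_deldbar hc, smul_zero]
  oneOne x u v := by
    have hc : ContDiffAt ℝ 2 (localRep φ (chartAt (Cn n) x)) (chartAt (Cn n) x x) :=
      ((contDiffOn_localRep φ (chart_mem_atlas _ x)).contDiffAt
        ((chartAt (Cn n) x).open_target.mem_nhds (mem_chart_target _ x))).of_le two_le_infty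
    rw [iDeldbar_apply]
    have h := congrArg (fun b : Cn n [⋀^Fin 2]→L[ℝ] ℂ => b ![u, v]) (deldbar_comp_mulI hc)
    have h2 : ![tangentJ x u, tangentJ x v] = mulI n ∘ ![u, v] := by
      funext k; fin_cases k <;> rfl
    rw [h2]
    exact congrArg (Complex.I * ·) h

end Charts

/-! ### Closed subsets of chart domains and their images. -/

section ChartImages

theorem isCompact_chart_image {n : ℕ} {X : Type*} [TopologicalSpace X] [CompactSpace X]
    {e : OpenPartialHomeomorph X (Cn n)} {K : Set X}
    (hK : IsClosed K) (hKe : K ⊆ e.source) : IsCompact (e '' K) :=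
  hK.isCompact.image_of_continuousOn (e.continuousOn.mono hKe)

theorem chart_image_subset {n : ℕ} {X : Type*} [TopologicalSpace X] {e : OpenPartialHomeomorph X (Cn n)}
    {K : Set X} (hKe : K ⊆ e.source) :
    e '' K ⊆ e.target := by
  rintro _ ⟨x, hx, rfl⟩
  exact e.map_source (hKe hx)

theorem symm_notMem_of_mem_sdiff_image {n : ℕ} {X : Type*} [TopologicalSpace X]
    {e : OpenPartialHomeomorph X (Cn n)} {K : Set X} {y : Cn n} (hy : y ∈ e.target \ (e '' K)) : e.symm y ∉ K :=
  fun h => hy.2 ⟨e.symm y, h, e.right_inv hy.1⟩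

end ChartImages

/-! ### Smooth forms, families of forms, and change of chart. -/

section SmoothForms

variable {n : ℕ} {X : Type*} [TopologicalSpace X] [ChartedSpace (Cn n) X] {ι : Type}

/-- Forms whose coefficients in the preferred charts are smooth. -/
def DiffForm.IsSmoothInCharts (η : DiffForm n X ι) : Prop :=
  ∀ (c : X) (w : ι → Cn n), ContDiffOn ℝ ∞
    (fun y => DiffForm.inChart η (chartAt (Cn n) c) y w) (chartAt (Cn n) c).target

/-- Families of forms `η_t` whose coefficients in the preferred charts are smooth
in `(t, y)`. -/
def DiffForm.IsSmoothFamily (η : ℝ → DiffForm n X ι) : Prop :=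
  ∀ (c : X) (w : ι → Cn n), ContDiffOn ℝ ∞
    (fun p : ℝ × Cn n => DiffForm.inChart (η p.1) (chartAt (Cn n) c) p.2 w)
    (Set.univ ×ˢ (chartAt (Cn n) c).target)

theorem DiffForm.IsSmoothFamily.isSmoothInCharts {η : ℝ → DiffForm n X ι}
    (h : DiffForm.IsSmoothFamily η) (t : ℝ) : DiffForm.IsSmoothInCharts (η t) := fun c w =>
  (h c w).comp (contDiffOn_const.prodMk contDiffOn_id) fun _ hy => ⟨Set.mem_univ _, hy⟩

theorem DiffForm.IsSmoothInCharts.isSmoothFamily {η : DiffForm n X ι}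
    (h : DiffForm.IsSmoothInCharts η) : DiffForm.IsSmoothFamily fun _ => η := fun c w =>
  (h c w).comp contDiffOn_snd fun _ hp => hp.2

theorem TwoForm.IsSmooth.isSmoothInCharts {β : TwoForm n X} (h : TwoForm.IsSmooth β) :
    DiffForm.IsSmoothInCharts β := fun c w =>
  contDiffOn_form_apply (h _ (chart_mem_atlas _ c)) w

theorem inChart_wedgeTwoForms (β : Fin n → TwoForm n X) (e : OpenPartialHomeomorph X (Cn n))
    (y : Cn n) :
    DiffForm.inChart (fun x => wedgeTwoForms fun j => β j x : TopForm n X) e y =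
      wedgeTwoForms fun j => DiffForm.inChart (β j) e y := by
  rw [DiffForm.inChart]
  exact wedgeTwoForms_compContinuousLinearMap _ _

theorem DiffForm.IsSmoothFamily.wedge {β : Fin n → ℝ → TwoForm n X}
    (h : ∀ j, DiffForm.IsSmoothFamily (β j)) :
    DiffForm.IsSmoothFamily (fun t x => wedgeTwoForms fun j => β j t x : ℝ → TopForm n X) := by
  intro c w
  simp only [inChart_wedgeTwoForms (fun j => β j _), wedgeTwoForms_apply]
  refine ContDiffOn.const_smul _ (ContDiffOn.sum fun s _ => ?_)
  simp only [Units.smul_def, zsmul_eq_mul]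
  exact contDiffOn_const.mul (contDiffOn_prod fun j _ => h j c _)

theorem DiffForm.IsSmoothInCharts.wedge {β : Fin n → TwoForm n X}
    (h : ∀ j, DiffForm.IsSmoothInCharts (β j)) :
    DiffForm.IsSmoothInCharts (fun x => wedgeTwoForms fun j => β j x : TopForm n X) :=
  (DiffForm.IsSmoothFamily.wedge fun j => (h j).isSmoothFamily).isSmoothInCharts 0

theorem DiffForm.IsSmoothInCharts.add {η η' : DiffForm n X ι} (h : DiffForm.IsSmoothInCharts η)
    (h' : DiffForm.IsSmoothInCharts η') : DiffForm.IsSmoothInCharts fun x => η x + η' x :=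
  fun c w => (h c w).add (h' c w)

theorem DiffForm.IsSmoothInCharts.const_smul {η : DiffForm n X ι}
    (h : DiffForm.IsSmoothInCharts η) (a : ℂ) : DiffForm.IsSmoothInCharts fun x => a • η x :=
  fun c w => (h c w).const_smul a

theorem DiffForm.IsSmoothInCharts.fnMul [IsManifold 𝓘(ℂ, Cn n) ω X] {η : TopForm n X}
    (h : DiffForm.IsSmoothInCharts η)
    (φ : SmoothFn n X) : DiffForm.IsSmoothInCharts (fnMul φ η) := fun c w => by
  refine ((contDiffOn_localRep φ (chart_mem_atlas _ c)).mul (h c w)).congr fun y _ => ?_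
  exact Complex.real_smul

/-- The real Jacobian is the squared modulus of the complex one, so the absolute value required by
the change of variables formula costs nothing. -/
theorem inChart_transition_stdFrame [IsManifold 𝓘(ℂ, Cn n) ω X] (η : TopForm n X) {e e' : OpenPartialHomeomorph X (Cn n)}
    (he : e ∈ atlas (Cn n) X) (he' : e' ∈ atlas (Cn n) X) {y : Cn n}
    (hy : y ∈ transitionDomain e e') :
    DiffForm.inChart η e y (stdFrame n) = |(fderiv ℝ (fun z => e' (e.symm z)) y).det| •
      DiffForm.inChart η e' (e' (e.symm y)) (stdFrame n) := by
  have hd : (fderiv ℝ (fun z => e' (e.symm z)) y).det =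
      Complex.normSq (fderiv ℂ (fun z => e' (e.symm z)) y).det := by
    rw [((contDiffAt_complex_transition he he' hy).differentiableAt (by simp)).fderiv_restrictScalars
      ℝ, det_restrictScalars_eq_normSq]
  rw [inChart_transition η he he' hy, abs_of_nonneg (hd ▸ Complex.normSq_nonneg _)]
  exact topForm_comp_stdFrame (DiffForm.inChart η e' (e' (e.symm y))) _

open MeasureTheory in
/-- Independence of the integral of a top form from the chart. -/
theorem setIntegral_chart_transition [IsManifold 𝓘(ℂ, Cn n) ω X] (g : X → ℝ) (η : TopForm n X)
    {e e' : OpenPartialHomeomorph X (Cn n)} (he : e ∈ atlas (Cn n) X) (he' : e' ∈ atlas (Cn n) X)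
    (h : ∀ x, x ∉ e.source ∩ e'.source → g x = 0 ∨ η x = 0) :
    ∫ y in e.target, g (e.symm y) • DiffForm.inChart η e y (stdFrame n) =
      ∫ y in e'.target, g (e'.symm y) • DiffForm.inChart η e' y (stdFrame n) := by
  -- Off the overlap of the charts g or η vanishes, so both integrals reduce to the two images of
  -- the overlap.
  have restrict : ∀ {e e' : OpenPartialHomeomorph X (Cn n)},
      (∀ x, x ∉ e.source ∩ e'.source → g x = 0 ∨ η x = 0) →
      ∫ y in transitionDomain e e', g (e.symm y) • DiffForm.inChart η e y (stdFrame n) =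
        ∫ y in e.target, g (e.symm y) • DiffForm.inChart η e y (stdFrame n) := by
    intro e e' h
    refine (setIntegral_eq_of_subset_of_forall_sdiff_eq_zero e.open_target.measurableSet
      Set.inter_subset_left fun y hy => ?_).symm
    rcases h (e.symm y) fun hx => hy.2 ⟨hy.1, hx.2⟩ with h0 | h0
    · rw [h0, zero_smul]
    · rw [DiffForm.inChart, h0]
      exact smul_zero _
  rw [← restrict h, ← restrict fun x hx => h x fun hx' => hx ⟨hx'.2, hx'.1⟩]
  have himg : transitionDomain e' e = (fun z => e' (e.symm z)) '' transitionDomain e e' := by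
    ext z
    constructor
    · intro hz
      refine ⟨e (e'.symm z), ⟨e.map_source hz.2, ?_⟩, ?_⟩
      · rw [Set.mem_preimage, e.left_inv hz.2]
        exact e'.map_target hz.1
      · simp only [e.left_inv hz.2, e'.right_inv hz.1]
    · rintro ⟨y, hy, rfl⟩
      refine ⟨e'.map_source hy.2, ?_⟩
      simp only [Set.mem_preimage, e'.left_inv hy.2]
      exact e.map_target hy.1
  have hinj : Set.InjOn (fun z => e' (e.symm z)) (transitionDomain e e') := fun y hy z hz hyz =>
    e.symm.injOn hy.1 hz.1 (e'.injOn hy.2 hz.2 hyz)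
  rw [himg, integral_image_eq_integral_abs_det_fderiv_smul volume
    (isOpen_transitionDomain e e').measurableSet
    (fun y hy => ((contDiffAt_transition he he' hy).differentiableAt
      (by simp)).hasFDerivAt.hasFDerivWithinAt) hinj]
  refine setIntegral_congr_fun (isOpen_transitionDomain e e').measurableSet fun y hy => ?_
  simp only [e'.left_inv hy.2]
  rw [inChart_transition_stdFrame η he he' hy, smul_comm]

end SmoothForms

/-! ### The integral of top-degree forms over X. -/

section Integral

open MeasureTheory

variable {n : ℕ} {X : Type*} [TopologicalSpace X] [ChartedSpace (Cn n) X]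
  [T2Space X] [CompactSpace X] [IsManifold 𝓘(ℂ, Cn n) ω X]

variable (n X) in
theorem finite_chartPartition : {c : X | ∃ x, chartPartition n X c x ≠ 0}.Finite :=
  (chartPartition n X).locallyFinite.finite_nonempty_of_compact

variable (n X) in
/-- The charts that contribute to the partition of unity. -/
noncomputable def chartIndex : Finset X := (finite_chartPartition n X).toFinset

theorem chartPartition_eq_zero {c : X} (hc : c ∉ chartIndex n X) (x : X) :
    chartPartition n X c x = 0 := by
  by_contra h
  exact hc ((finite_chartPartition n X).mem_toFinset.2 ⟨x, h⟩)

theorem sum_chartPartition (x : X) : ∑ c ∈ chartIndex n X, chartPartition n X c x = 1 := by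
  rw [← (chartPartition n X).sum_eq_one (Set.mem_univ x)]
  refine (finsum_eq_sum_of_support_subset _ fun c hc => ?_).symm
  by_contra h
  exact hc (chartPartition_eq_zero h x)

theorem tsupport_chartPartition_subset (c : X) :
    tsupport (chartPartition n X c) ⊆ (chartAt (Cn n) c).source :=
  (exists_chartPartition n X).choose_spec c

/-- By compactness only finitely many members of the locally finite partition are nonzero. -/
theorem integralForm_eq_sum (η : TopForm n X) :
    integralForm η = ∑ c ∈ chartIndex n X, ∫ y in (chartAt (Cn n) c).target,
      chartPartition n X c ((chartAt (Cn n) c).symm y) •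
        DiffForm.inChart η (chartAt (Cn n) c) y (stdFrame n) := by
  refine finsum_eq_sum_of_support_subset _ fun c hc => ?_
  by_contra h
  exact hc (by simp [chartPartition_eq_zero h])

theorem continuousOn_chartPartition (c a : X) :
    ContinuousOn (fun y => chartPartition n X c ((chartAt (Cn n) a).symm y))
      (chartAt (Cn n) a).target :=
  (chartPartition n X c).contMDiff.continuous.comp_continuousOn (chartAt (Cn n) a).continuousOn_symm

theorem integrableOn_chart {η : TopForm n X} (h : DiffForm.IsSmoothInCharts η) (c : X) :
    IntegrableOn (fun y => chartPartition n X c ((chartAt (Cn n) c).symm y) •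
      DiffForm.inChart η (chartAt (Cn n) c) y (stdFrame n)) (chartAt (Cn n) c).target := by
  refine integrableOn_of_eq_zero_off_compact (chartAt (Cn n) c).open_target
    (isCompact_chart_image (isClosed_tsupport _) (tsupport_chartPartition_subset c))
    (chart_image_subset (tsupport_chartPartition_subset c))
    ((continuousOn_chartPartition c c).smul (h c _).continuousOn) fun y hy => ?_
  rw [image_eq_zero_of_notMem_tsupport (symm_notMem_of_mem_sdiff_image hy), zero_smul]

theorem integralForm_add {η η' : TopForm n X} (h : DiffForm.IsSmoothInCharts η)
    (h' : DiffForm.IsSmoothInCharts η') :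
    integralForm (fun x => η x + η' x) = integralForm η + integralForm η' := by
  rw [integralForm_eq_sum, integralForm_eq_sum, integralForm_eq_sum, ← Finset.sum_add_distrib]
  refine Finset.sum_congr rfl fun c _ => ?_
  rw [← integral_add (integrableOn_chart h c) (integrableOn_chart h' c)]
  congr 1
  funext y
  exact smul_add _ _ _

theorem integralForm_const_smul (η : TopForm n X) (a : ℂ) :
    integralForm (fun x => a • η x) = a * integralForm η := by
  rw [integralForm_eq_sum, integralForm_eq_sum, Finset.mul_sum]
  refine Finset.sum_congr rfl fun c _ => ?_
  rw [← integral_const_mul]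
  congr 1
  funext y
  exact smul_comm _ a _

theorem integralForm_sub {η η' : TopForm n X} (h : DiffForm.IsSmoothInCharts η)
    (h' : DiffForm.IsSmoothInCharts η') :
    integralForm (fun x => η x - η' x) = integralForm η - integralForm η' := by
  have := integralForm_add h (h'.const_smul (-1))
  rw [integralForm_const_smul, neg_one_mul, ← sub_eq_add_neg] at this
  rw [← this]
  refine congrArg integralForm (funext fun x => ?_)
  rw [sub_eq_add_neg]
  exact congrArg (η x + ·) (neg_one_smul ℂ (η' x)).symm

theorem integralForm_zero : integralForm (fun _ => 0 : TopForm n X) = 0 := by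
  have := integralForm_const_smul (fun _ => 0 : TopForm n X) 0
  rw [zero_mul] at this
  rw [← this]
  exact congrArg integralForm (funext fun x =>
    ContinuousAlternatingMap.ext fun _ => (mul_zero (0 : ℂ)).symm)

/-- A top form supported in one chart can be integrated in that chart. -/
theorem integralForm_eq_setIntegral_chart {η : TopForm n X} (hη : DiffForm.IsSmoothInCharts η)
    (a : X) {K : Set X} (hK : IsClosed K) (hKa : K ⊆ (chartAt (Cn n) a).source)
    (h0 : ∀ x ∉ K, η x = 0) :
    integralForm η = ∫ y in (chartAt (Cn n) a).target,
      DiffForm.inChart η (chartAt (Cn n) a) y (stdFrame n) := by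
  -- Each ρ_c η lives in the overlap of the charts at c and a and can be moved to the latter, where
  -- the ρ_c sum to 1.
  have h1 : ∀ c ∈ chartIndex n X, ∫ y in (chartAt (Cn n) c).target,
      chartPartition n X c ((chartAt (Cn n) c).symm y) •
        DiffForm.inChart η (chartAt (Cn n) c) y (stdFrame n) =
      ∫ y in (chartAt (Cn n) a).target, chartPartition n X c ((chartAt (Cn n) a).symm y) •
        DiffForm.inChart η (chartAt (Cn n) a) y (stdFrame n) := fun c _ => by
    refine setIntegral_chart_transition (chartPartition n X c) η (chart_mem_atlas _ c)
      (chart_mem_atlas _ a) fun x hx => ?_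
    by_cases hxc : x ∈ (chartAt (Cn n) c).source
    · exact Or.inr (h0 x fun hxK => hx ⟨hxc, hKa hxK⟩)
    · exact Or.inl (image_eq_zero_of_notMem_tsupport fun h =>
        hxc (tsupport_chartPartition_subset c h))
  have h2 : ∀ c ∈ chartIndex n X, IntegrableOn (fun y =>
      chartPartition n X c ((chartAt (Cn n) a).symm y) •
        DiffForm.inChart η (chartAt (Cn n) a) y (stdFrame n)) (chartAt (Cn n) a).target := fun c _ =>
    integrableOn_of_eq_zero_off_compact (chartAt (Cn n) a).open_target
      (isCompact_chart_image hK hKa) (chart_image_subset hKa)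
      ((continuousOn_chartPartition c a).smul (hη a _).continuousOn) fun y hy => by
        rw [DiffForm.inChart, h0 _ (symm_notMem_of_mem_sdiff_image hy)]
        exact smul_zero _
  rw [integralForm_eq_sum, Finset.sum_congr rfl h1, ← integral_finsetSum _ h2]
  congr 1
  funext y
  rw [← Finset.sum_smul, sum_chartPartition, one_smul]

end Integral

/-! ### Symmetry of √-1∂∂̄ on X. -/

section GlobalSymmetry

open MeasureTheory

variable {n : ℕ} {X : Type*} [TopologicalSpace X] [ChartedSpace (Cn n) X]

theorem deldbar_zero (y : Cn n) : deldbar (fun _ => (0 : ℂ)) y = 0 := by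
  ext w
  rw [deldbar_apply contDiffAt_const]
  simp

theorem inChart_fnMul (φ : SmoothFn n X) (η : TopForm n X) (e : OpenPartialHomeomorph X (Cn n))
    (y : Cn n) (w : Fin n × Fin 2 → Cn n) :
    DiffForm.inChart (fnMul φ η) e y w = localRep φ e y * DiffForm.inChart η e y w :=
  Complex.real_smul

theorem iDeldbar_eq_zero {φ : SmoothFn n X} {x : X} (hx : x ∉ tsupport φ) : iDeldbar φ x = 0 := by
  set e := chartAt (Cn n) x with he
  have h : localRep φ e =ᶠ[nhds (e x)] fun _ => (0 : ℂ) := by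
    have h1 : ∀ᶠ z in nhds x, z ∉ tsupport φ := (isClosed_tsupport _).isOpen_compl.mem_nhds hx
    have h2 := (e.tendsto_symm (mem_chart_source _ x)).eventually h1
    filter_upwards [h2] with y hy
    simp [localRep, image_eq_zero_of_notMem_tsupport hy]
  rw [iDeldbar_apply, deldbar_congr h, deldbar_zero]
  exact ContinuousAlternatingMap.ext fun _ => mul_zero _

theorem isSmoothInCharts_update {β : Fin n → TwoForm n X}
    (hβ : ∀ j, DiffForm.IsSmoothInCharts (β j)) {κ : TwoForm n X}
    (hκ : DiffForm.IsSmoothInCharts κ) (i : Fin n) :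
    DiffForm.IsSmoothInCharts
      (fun x => wedgeTwoForms (Function.update (fun j => β j x) i (κ x)) : TopForm n X) := by
  have h : (fun x => wedgeTwoForms (Function.update (fun j => β j x) i (κ x)) : TopForm n X) =
      fun x => wedgeTwoForms fun j => Function.update β i κ j x := by
    funext x
    congr 1
    funext j
    by_cases hj : j = i
    · subst hj; simp
    · simp [hj]
  rw [h]
  refine DiffForm.IsSmoothInCharts.wedge fun j => ?_
  by_cases hj : j = i
  · subst hj; simpa using hκ
  · simpa [hj] using hβ j

theorem fnMul_add_left (φ φ' : SmoothFn n X) (η : TopForm n X) :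
    fnMul (φ + φ') η = fun x => fnMul φ η x + fnMul φ' η x :=
  funext fun x => ContinuousAlternatingMap.ext fun _ => add_smul (φ x) (φ' x) _

theorem fnMul_add_right (φ : SmoothFn n X) (η η' : TopForm n X) :
    (fnMul φ fun x => η x + η' x) = fun x => fnMul φ η x + fnMul φ η' x :=
  funext fun x => ContinuousAlternatingMap.ext fun _ => smul_add (φ x) _ _

variable [IsManifold 𝓘(ℂ, Cn n) ω X]

theorem iDeldbar_add (φ ψ : SmoothFn n X) (x : X) :
    iDeldbar (φ + ψ) x = iDeldbar φ x + iDeldbar ψ x := by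
  set e := chartAt (Cn n) x with he
  have hmem : e.target ∈ nhds (e x) := e.open_target.mem_nhds (mem_chart_target _ x)
  have hs : ∀ φ : SmoothFn n X, ContDiffAt ℝ ∞ (localRep φ e) (e x) := fun φ =>
    (contDiffOn_localRep φ (chart_mem_atlas _ x)).contDiffAt hmem
  have hf : ∀ φ : SmoothFn n X, ∀ᶠ y in nhds (e x), DifferentiableAt ℝ (localRep φ e) y := by
    intro φ
    filter_upwards [hmem] with y hy
    exact ((contDiffOn_localRep φ (chart_mem_atlas _ x)).contDiffAt
      (e.open_target.mem_nhds hy)).differentiableAt (by simp)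
  have hd : ∀ (φ : SmoothFn n X) (w : Cn n),
      DifferentiableAt ℝ (fun z => fderiv ℝ (localRep φ e) z w) (e x) := fun φ w =>
    (((hs φ).fderiv_right (m := ∞) (by simp)).differentiableAt (by simp)).clm_apply
      (differentiableAt_const w)
  have h : ∀ w : Cn n, (fun z => fderiv ℝ (localRep (φ + ψ) e) z w) =ᶠ[nhds (e x)]
      fun z => fderiv ℝ (localRep φ e) z w + fderiv ℝ (localRep ψ e) z w := by
    intro w
    filter_upwards [hf φ, hf ψ] with z h1 h2
    have : localRep (φ + ψ) e = fun z => localRep φ e z + localRep ψ e z := by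
      funext z
      simp [localRep]
    rw [this, fderiv_fun_add h1 h2]
    rfl
  refine ContinuousAlternatingMap.ext fun (w : Fin 2 → Cn n) => ?_
  have e0 := fun φ => deldbar_apply ((hs φ).of_le two_le_infty) w
  change Complex.I * deldbar (localRep (φ + ψ) e) (e x) w =
    Complex.I * deldbar (localRep φ e) (e x) w + Complex.I * deldbar (localRep ψ e) (e x) w
  rw [e0, e0, e0, (h _).fderiv_eq, (h _).fderiv_eq, fderiv_fun_add (hd _ _) (hd _ _),
    fderiv_fun_add (hd _ _) (hd _ _)]
  simp only [add_apply]
  ring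

theorem inChart_wedge_update_iDeldbar (β : Fin n → TwoForm n X) (ψ : SmoothFn n X) (i : Fin n)
    {e : OpenPartialHomeomorph X (Cn n)} (he : e ∈ atlas (Cn n) X) {y : Cn n} (hy : y ∈ e.target) :
    DiffForm.inChart
      (fun x => wedgeTwoForms (Function.update (fun j => β j x) i (iDeldbar ψ x)) : TopForm n X)
        e y = Complex.I • wedgeTwoForms
      (Function.update (fun j => DiffForm.inChart (β j) e y) i (deldbar (localRep ψ e) y)) := by
  rw [← wedgeTwoForms_update_smul, ← inChart_iDeldbar ψ he hy]
  refine (wedgeTwoForms_compContinuousLinearMap _ _).trans ?_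
  congr 1
  funext j
  by_cases hj : j = i
  · subst hj; simp; rfl
  · simp [hj]; rfl

variable [T2Space X] [CompactSpace X]

/-- Both integrands vanish off the support of φ: one contains φ, the other √-1∂∂̄φ. Hence both
integrals are computed in the chart at a, whatever the support of ψ, and local self-adjointness
applies. -/
theorem integralForm_wedge_iDeldbar_comm_of_tsupport_subset {β : Fin n → TwoForm n X}
    (hβ : ∀ j, IsClosedOneOne (β j)) (φ ψ : SmoothFn n X) (i : Fin n) {a : X}
    (ha : tsupport φ ⊆ (chartAt (Cn n) a).source) :
    integralForm (fnMul φ fun x =>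
        wedgeTwoForms (Function.update (fun j => β j x) i (iDeldbar ψ x))) =
      integralForm (fnMul ψ fun x =>
        wedgeTwoForms (Function.update (fun j => β j x) i (iDeldbar φ x))) := by
  set e := chartAt (Cn n) a with he
  have hea : e ∈ atlas (Cn n) X := chart_mem_atlas _ a
  have hs : ∀ φ ψ : SmoothFn n X, DiffForm.IsSmoothInCharts (fnMul φ fun x =>
      wedgeTwoForms (Function.update (fun j => β j x) i (iDeldbar ψ x))) := fun φ ψ =>
    (isSmoothInCharts_update (fun j => (hβ j).smooth.isSmoothInCharts)
      (isClosedOneOne_iDeldbar ψ).smooth.isSmoothInCharts i).fnMul φ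
  have hc : ∀ φ ψ : SmoothFn n X, (∀ x ∉ tsupport (φ : X → ℝ), fnMul φ (fun x =>
      wedgeTwoForms (Function.update (fun j => β j x) i (iDeldbar ψ x))) x = 0) ∧
      (∀ x ∉ tsupport (ψ : X → ℝ), fnMul φ (fun x =>
      wedgeTwoForms (Function.update (fun j => β j x) i (iDeldbar ψ x))) x = 0) := by
    intro φ ψ
    refine ⟨fun x hx => ?_, fun x hx => ?_⟩
    · rw [fnMul, image_eq_zero_of_notMem_tsupport hx]
      exact ContinuousAlternatingMap.ext fun _ => zero_smul ℝ (_ : ℂ)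
    -- A zero factor kills the wedge product: homogeneity in slot i with scalar 0.
    · have h0 := wedgeTwoForms_update_smul (fun j => β j x) i 0 (iDeldbar ψ x)
      have h1 : (0 : ℂ) • iDeldbar ψ x = iDeldbar ψ x := by
        rw [iDeldbar_eq_zero hx]
        exact ContinuousAlternatingMap.ext fun _ => mul_zero _
      rw [h1] at h0
      rw [fnMul, h0]
      exact ContinuousAlternatingMap.ext fun v => by
        change φ x • ((0 : ℂ) * _) = 0
        rw [zero_mul, smul_zero]
  rw [integralForm_eq_setIntegral_chart (hs φ ψ) a (isClosed_tsupport _) ha (hc φ ψ).1,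
    integralForm_eq_setIntegral_chart (hs ψ φ) a (isClosed_tsupport _) ha (hc ψ φ).2, ← sub_eq_zero]
  have hi : ∀ φ' ψ' : SmoothFn n X, (∀ x ∉ tsupport (φ : X → ℝ), fnMul φ' (fun x =>
      wedgeTwoForms (Function.update (fun j => β j x) i (iDeldbar ψ' x))) x = 0) →
      IntegrableOn (fun y => DiffForm.inChart (fnMul φ' fun x =>
        wedgeTwoForms (Function.update (fun j => β j x) i (iDeldbar ψ' x))) e y (stdFrame n))
        e.target := fun φ' ψ' h =>
    integrableOn_of_eq_zero_off_compact e.open_target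
      (isCompact_chart_image (isClosed_tsupport _) ha) (chart_image_subset ha)
      (hs φ' ψ' a _).continuousOn fun y hy => by
        rw [DiffForm.inChart, h _ (symm_notMem_of_mem_sdiff_image hy)]
        rfl
  rw [← integral_sub (hi φ ψ (hc φ ψ).1) (hi ψ φ (hc ψ φ).2)]
  have key := setIntegral_wedge_deldbar_comm e.open_target
    (isCompact_chart_image (isClosed_tsupport _) ha) (chart_image_subset ha)
    (β := fun j => DiffForm.inChart (β j) e) (fun j => (hβ j).smooth e hea)
    (fun j => (hβ j).closed e hea) (fun j y hy => inChart_comp_mulI (hβ j).oneOne hea hy)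
    (contDiffOn_localRep φ hea) (contDiffOn_localRep ψ hea) (fun y hy => by
      simp [localRep, image_eq_zero_of_notMem_tsupport (symm_notMem_of_mem_sdiff_image hy)]) i
  rw [← mul_zero Complex.I, ← key, ← integral_const_mul]
  refine setIntegral_congr_fun e.open_target.measurableSet fun y hy => ?_
  simp only [inChart_fnMul]
  rw [inChart_wedge_update_iDeldbar β φ i hea hy, inChart_wedge_update_iDeldbar β ψ i hea hy]
  simp only [ContinuousAlternatingMap.smul_apply, smul_eq_mul]
  ring

/-- `∫ φ √-1∂∂̄ψ ∧ ⋀ βⱼ` is symmetric in `φ` and `ψ` for closed `(1,1)`-forms `βⱼ`. -/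
theorem integralForm_wedge_iDeldbar_comm {β : Fin n → TwoForm n X}
    (hβ : ∀ j, IsClosedOneOne (β j)) (φ ψ : SmoothFn n X) (i : Fin n) :
    integralForm (fnMul φ fun x =>
        wedgeTwoForms (Function.update (fun j => β j x) i (iDeldbar ψ x))) =
      integralForm (fnMul ψ fun x =>
        wedgeTwoForms (Function.update (fun j => β j x) i (iDeldbar φ x))) := by
  have hs : ∀ φ ψ : SmoothFn n X, DiffForm.IsSmoothInCharts (fnMul φ fun x =>
      wedgeTwoForms (Function.update (fun j => β j x) i (iDeldbar ψ x))) := fun φ ψ =>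
    (isSmoothInCharts_update (fun j => (hβ j).smooth.isSmoothInCharts)
      (isClosedOneOne_iDeldbar ψ).smooth.isSmoothInCharts i).fnMul φ
  -- Both sides are additive in φ, so it suffices to treat each ρ_c φ, which is supported in one
  -- chart.
  have hφ : φ = ∑ c ∈ chartIndex n X, chartPartition n X c * φ := by
    ext x
    have : (∑ c ∈ chartIndex n X, chartPartition n X c * φ : SmoothFn n X) x =
        ∑ c ∈ chartIndex n X, chartPartition n X c x * φ x := by
      rw [← ContMDiffMap.coeFnAddMonoidHom_apply, map_sum, Finset.sum_apply]
      rfl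
    rw [this, ← Finset.sum_mul, sum_chartPartition, one_mul]
  rw [hφ]
  refine Finset.sum_induction (fun c => chartPartition n X c * φ) (fun φ : SmoothFn n X =>
    integralForm (fnMul φ fun x =>
        wedgeTwoForms (Function.update (fun j => β j x) i (iDeldbar ψ x))) =
      integralForm (fnMul ψ fun x =>
        wedgeTwoForms (Function.update (fun j => β j x) i (iDeldbar φ x)))) ?_ ?_ ?_
  · intro φ φ' h h'
    rw [fnMul_add_left, integralForm_add (hs _ _) (hs _ _), h, h']
    simp only [iDeldbar_add, wedgeTwoForms_update_add]
    rw [← integralForm_add (hs _ _) (hs _ _), ← fnMul_add_right]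
  -- The zero function is supported in any chart, but naming a chart requires a point of X.
  · rcases isEmpty_or_nonempty X with hX | ⟨⟨a⟩⟩
    · exact congrArg integralForm (funext fun x => isEmptyElim x)
    · refine integralForm_wedge_iDeldbar_comm_of_tsupport_subset hβ 0 ψ i (a := a) ?_
      rw [ContMDiffMap.coe_zero, tsupport_zero]
      exact Set.empty_subset _
  · intro c _
    refine integralForm_wedge_iDeldbar_comm_of_tsupport_subset hβ _ ψ i (a := c) ?_
    exact (tsupport_mul_subset_left).trans (tsupport_chartPartition_subset c)

end GlobalSymmetry

/-! ### Differentiation under the integral sign. -/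

section ParametricIntegrals

open MeasureTheory

theorem hasDerivAt_slice_left {E : Type*} [NormedAddCommGroup E] [NormedSpace ℝ E]
    {G : ℝ × E → ℂ} {t : ℝ} {y : E} (hG : DifferentiableAt ℝ G (t, y)) :
    HasDerivAt (fun s => G (s, y)) (fderiv ℝ G (t, y) (1, 0)) t :=
  hG.hasFDerivAt.comp_hasDerivAt t ((hasDerivAt_id t).prodMk (hasDerivAt_const t y))

theorem fderiv_slice_right {E : Type*} [NormedAddCommGroup E] [NormedSpace ℝ E]
    {G : ℝ × E → ℂ} {t : ℝ} {y : E} (hG : DifferentiableAt ℝ G (t, y)) (w : E) :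
    fderiv ℝ (fun z => G (t, z)) y w = fderiv ℝ G (t, y) (0, w) := by
  have h := hG.hasFDerivAt.comp y ((hasFDerivAt_const t y).prodMk (hasFDerivAt_id y))
  have h' := h.fderiv
  change fderiv ℝ (fun z => G (t, z)) y = _ at h'
  rw [h']
  rfl

/-- Since ρ vanishes off K, the t-derivative of the integrand near t is dominated by its maximum
over the compact set [t-1, t+1] × K, times the indicator of K. -/
theorem hasDerivAt_setIntegral_smul {E : Type*} [NormedAddCommGroup E] [NormedSpace ℝ E]
    [FiniteDimensional ℝ E] [MeasurableSpace E] [BorelSpace E] {μ : Measure E}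
    [IsFiniteMeasureOnCompacts μ] {U K : Set E} (hU : IsOpen U) (hK : IsCompact K) (hKU : K ⊆ U)
    {ρ : E → ℝ} (hρ : ContinuousOn ρ U) (h0 : ∀ y ∈ U \ K, ρ y = 0) {G : ℝ × E → ℂ}
    (hG : ContDiffOn ℝ ∞ G (Set.univ ×ˢ U)) (t : ℝ) :
    HasDerivAt (fun s => ∫ y in U, ρ y • G (s, y) ∂μ)
      (∫ y in U, ρ y • fderiv ℝ G (t, y) (1, 0) ∂μ) t := by
  have hUo : IsOpen ((Set.univ : Set ℝ) ×ˢ U) := isOpen_univ.prod hU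
  have hG' := contDiffOn_fderiv_apply hUo hG ((1 : ℝ), (0 : E))
  have hd : ∀ s, ∀ y ∈ U, DifferentiableAt ℝ G (s, y) := fun s y hy =>
    (hG.contDiffAt (hUo.mem_nhds ⟨Set.mem_univ _, hy⟩)).differentiableAt (by simp)
  have hslice : ∀ {H : ℝ × E → ℂ}, ContDiffOn ℝ ∞ H (Set.univ ×ˢ U) → ∀ s,
      ContinuousOn (fun y => ρ y • H (s, y)) U := fun hH s =>
    hρ.smul (hH.continuousOn.comp (continuousOn_const.prodMk continuousOn_id)
      fun _ hy => ⟨Set.mem_univ _, hy⟩)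
  obtain ⟨C, hC⟩ := ((isCompact_closedBall t 1).prod hK).exists_bound_of_continuousOn
    (f := fun p : ℝ × E => ρ p.2 • fderiv ℝ G p (1, 0))
    ((hρ.comp continuousOn_snd fun _ hp => hKU hp.2).smul
      (hG'.continuousOn.mono fun p hp => ⟨Set.mem_univ _, hKU hp.2⟩))
  refine (hasDerivAt_integral_of_dominated_loc_of_deriv_le (bound := K.indicator fun _ => C)
    (F' := fun s y => ρ y • fderiv ℝ G (s, y) (1, 0))
    (Metric.closedBall_mem_nhds t one_pos)
    (Filter.Eventually.of_forall fun s => (hslice hG s).aestronglyMeasurable hU.measurableSet)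
    (integrableOn_of_eq_zero_off_compact hU hK hKU (hslice hG t) fun y hy => by
      rw [h0 y hy, zero_smul])
    ((hslice hG' t).aestronglyMeasurable hU.measurableSet) ?_ ?_ ?_).2
  · refine ae_restrict_of_forall_mem hU.measurableSet fun y hy s hs => ?_
    by_cases hyK : y ∈ K
    · rw [Set.indicator_of_mem hyK]
      exact hC (s, y) ⟨hs, hyK⟩
    · rw [h0 y ⟨hy, hyK⟩, zero_smul, norm_zero, Set.indicator_of_notMem hyK]
  · exact (((continuousOn_const (c := C)).integrableOn_compact hK).integrable_indicator
      hK.measurableSet).integrableOn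
  · exact ae_restrict_of_forall_mem hU.measurableSet fun y hy s _ =>
      (hasDerivAt_slice_left (hd s y hy)).const_smul (ρ y)

end ParametricIntegrals

/-! ### Smooth families of functions and forms along a path. -/

section FormFamilies

variable {n : ℕ} {X : Type*} [TopologicalSpace X] [ChartedSpace (Cn n) X]

/-- Families of functions that are smooth in `(t, y)` in the preferred charts. -/
def IsSmoothFnFamily (φ : ℝ → SmoothFn n X) : Prop :=
  ∀ c : X, ContDiffOn ℝ ∞ (fun p : ℝ × Cn n => localRep (φ p.1) (chartAt (Cn n) c) p.2)
    (Set.univ ×ˢ (chartAt (Cn n) c).target)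

theorem DiffForm.IsSmoothFamily.fnMul {η : ℝ → TopForm n X} (h : DiffForm.IsSmoothFamily η)
    {φ : ℝ → SmoothFn n X} (hφ : IsSmoothFnFamily φ) :
    DiffForm.IsSmoothFamily fun t => fnMul (φ t) (η t) := fun c w =>
  ((hφ c).mul (h c w)).congr fun _ _ => inChart_fnMul _ _ _ _ _

theorem DiffForm.IsSmoothFamily.add_const_smul {ι : Type} {η η' : ℝ → DiffForm n X ι}
    (h : DiffForm.IsSmoothFamily η) (h' : DiffForm.IsSmoothFamily η') (a : ℂ) :
    DiffForm.IsSmoothFamily fun t x => η t x + a • η' t x := fun c w =>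
  (h c w).add ((h' c w).const_smul a)

theorem hasDerivAt_wedgeTwoForms {V : Type*} [AddCommGroup V] [Module ℝ V] [TopologicalSpace V]
    {β : Fin n → ℝ → V [⋀^Fin 2]→L[ℝ] ℂ} {β' : Fin n → V [⋀^Fin 2]→L[ℝ] ℂ} {t : ℝ}
    (h : ∀ j w, HasDerivAt (fun s => β j s w) (β' j w) t) (v : Fin n × Fin 2 → V) :
    HasDerivAt (fun s => wedgeTwoForms (fun j => β j s) v)
      (∑ i, wedgeTwoForms (Function.update (fun j => β j t) i (β' i)) v) t := by
  simp only [wedgeTwoForms_update_apply]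
  simp only [wedgeTwoForms_apply]
  rw [← Finset.smul_sum, Finset.sum_comm]
  refine HasDerivAt.fun_const_smul _ (HasDerivAt.fun_sum fun s _ => ?_)
  rw [← Finset.smul_sum]
  simp only [Units.smul_def, zsmul_eq_mul]
  refine HasDerivAt.const_mul _ ?_
  refine (HasDerivAt.fun_finsetProd fun i _ => h i _).congr_deriv ?_
  refine Finset.sum_congr rfl fun i _ => ?_
  rw [smul_eq_mul, mul_comm]

/-- Rewrites space derivatives at fixed t as derivatives on ℝ × ℂⁿ in directions (0, w), so that
joint smoothness in (t, y) is inherited by them. -/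
theorem fderiv_fderiv_localRep {φ : ℝ → SmoothFn n X} (hφ : IsSmoothFnFamily φ) (c : X) (t : ℝ)
    {y : Cn n} (hy : y ∈ (chartAt (Cn n) c).target) (u w : Cn n) :
    fderiv ℝ (fun z => fderiv ℝ (localRep (φ t) (chartAt (Cn n) c)) z w) y u =
      fderiv ℝ (fun q => fderiv ℝ
        (fun p : ℝ × Cn n => localRep (φ p.1) (chartAt (Cn n) c) p.2) q (0, w)) (t, y) (0, u) := by
  have hU := isOpen_univ.prod (chartAt (Cn n) c).open_target (X := ℝ)
  have hd : ∀ {G : ℝ × Cn n → ℂ}, ContDiffOn ℝ ∞ G (Set.univ ×ˢ (chartAt (Cn n) c).target) →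
      ∀ z ∈ (chartAt (Cn n) c).target, DifferentiableAt ℝ G (t, z) := fun hG z hz =>
    (hG.contDiffAt (hU.mem_nhds ⟨Set.mem_univ _, hz⟩)).differentiableAt (by simp)
  have h1 : (fun z => fderiv ℝ (localRep (φ t) (chartAt (Cn n) c)) z w) =ᶠ[nhds y] fun z =>
      fderiv ℝ (fun p : ℝ × Cn n => localRep (φ p.1) (chartAt (Cn n) c) p.2) (t, z) (0, w) := by
    filter_upwards [(chartAt (Cn n) c).open_target.mem_nhds hy] with z hz
    exact fderiv_slice_right
      (G := fun p : ℝ × Cn n => localRep (φ p.1) (chartAt (Cn n) c) p.2) (hd (hφ c) z hz) w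
  rw [h1.fderiv_eq]
  exact fderiv_slice_right (G := fun q => fderiv ℝ
    (fun p : ℝ × Cn n => localRep (φ p.1) (chartAt (Cn n) c) p.2) q (0, w))
    (hd (contDiffOn_fderiv_apply hU (hφ c) _) y hy) u

variable [IsManifold 𝓘(ℂ, Cn n) ω X]

/-- A pointwise derivative on fixed tangent vectors suffices: the frame pushed forward by a chart
does not depend on the parameter, so η' must be the t-derivative of the chart coefficients. -/
theorem hasDerivAt_integralForm [T2Space X] [CompactSpace X] {η : ℝ → TopForm n X}
    (hη : DiffForm.IsSmoothFamily η) {η' : TopForm n X} {t : ℝ}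
    (h : ∀ x w, HasDerivAt (fun s => η s x w) (η' x w) t) :
    HasDerivAt (fun s => integralForm (η s)) (integralForm η') t := by
  simp only [integralForm_eq_sum]
  refine HasDerivAt.fun_sum fun c _ => ?_
  have hK := tsupport_chartPartition_subset (n := n) (X := X) c
  refine (hasDerivAt_setIntegral_smul (chartAt (Cn n) c).open_target
    (isCompact_chart_image (isClosed_tsupport _) hK) (chart_image_subset hK)
    (continuousOn_chartPartition c c) (fun y hy =>
      image_eq_zero_of_notMem_tsupport (symm_notMem_of_mem_sdiff_image hy))
    (hη c (stdFrame n)) t).congr_deriv ?_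
  refine MeasureTheory.setIntegral_congr_fun (chartAt (Cn n) c).open_target.measurableSet
    fun y hy => ?_
  have hd : DifferentiableAt ℝ (fun p : ℝ × Cn n =>
      DiffForm.inChart (η p.1) (chartAt (Cn n) c) p.2 (stdFrame n)) (t, y) :=
    ((hη c (stdFrame n)).contDiffAt ((isOpen_univ.prod (chartAt (Cn n) c).open_target).mem_nhds
      ⟨Set.mem_univ _, hy⟩)).differentiableAt (by simp)
  congr 1
  refine (hasDerivAt_slice_left hd).unique ?_
  simp only [inChart_apply _ (chart_mem_atlas (Cn n) c) hy]
  exact h _ _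

theorem continuous_integralForm [T2Space X] [CompactSpace X] {η : ℝ → TopForm n X}
    (hη : DiffForm.IsSmoothFamily η) : Continuous fun s => integralForm (η s) := by
  simp only [integralForm_eq_sum]
  refine continuous_finsetSum _ fun c _ => ?_
  have hK := tsupport_chartPartition_subset (n := n) (X := X) c
  exact continuous_iff_continuousAt.2 fun t =>
    (hasDerivAt_setIntegral_smul (chartAt (Cn n) c).open_target
      (isCompact_chart_image (isClosed_tsupport _) hK) (chart_image_subset hK)
      (continuousOn_chartPartition c c) (fun y hy =>
        image_eq_zero_of_notMem_tsupport (symm_notMem_of_mem_sdiff_image hy))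
      (hη c (stdFrame n)) t).continuousAt

theorem SmoothPath.isSmoothFnFamily (γ : SmoothPath n X) : IsSmoothFnFamily γ.toFun := by
  have : IsManifold 𝓘(ℝ, Cn n) ∞ X := isManifold_real_of_complex n X
  intro c
  have h1 : ContMDiffOn 𝓘(ℝ, ℝ × Cn n) 𝓘(ℝ, Cn n) ∞
      (fun p : ℝ × Cn n => (chartAt (Cn n) c).symm p.2)
      (Set.univ ×ˢ (chartAt (Cn n) c).target) :=
    (contMDiffOn_symm_of_mem_maximalAtlas (I := 𝓘(ℝ, Cn n)) (n := ∞)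
      (IsManifold.chart_mem_maximalAtlas c)).comp contDiff_snd.contMDiff.contMDiffOn
      fun p hp => hp.2
  have h2 : ContMDiffOn 𝓘(ℝ, ℝ × Cn n) 𝓘(ℝ, ℝ) ∞ (fun p : ℝ × Cn n => p.1)
      (Set.univ ×ˢ (chartAt (Cn n) c).target) := contDiff_fst.contMDiff.contMDiffOn
  have h3 := contMDiffOn_iff_contDiffOn.1 (γ.smooth.comp_contMDiffOn (h2.prodMk h1))
  exact Complex.ofRealCLM.contDiff.comp_contDiffOn h3

theorem SmoothPath.hasDerivAt (γ : SmoothPath n X) (t : ℝ) (x : X) :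
    HasDerivAt (fun s => γ.toFun s x) (γ.velocity t x) t := by
  have h : ContDiff ℝ ∞ fun s : ℝ => γ.toFun s x :=
    contMDiff_iff_contDiff.1 (γ.smooth.comp (contMDiff_id.prodMk contMDiff_const))
  exact (h.differentiable (by simp) t).hasDerivAt

theorem SmoothPath.localRep_velocity (γ : SmoothPath n X) (c : X) (t : ℝ) {y : Cn n}
    (hy : y ∈ (chartAt (Cn n) c).target) :
    localRep (γ.velocity t) (chartAt (Cn n) c) y =
      fderiv ℝ (fun p : ℝ × Cn n => localRep (γ.toFun p.1) (chartAt (Cn n) c) p.2) (t, y)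
        (1, 0) :=
  ((γ.hasDerivAt t _).ofReal_comp).unique (hasDerivAt_slice_left
    (((γ.isSmoothFnFamily c).contDiffAt ((isOpen_univ.prod
      (chartAt (Cn n) c).open_target).mem_nhds ⟨Set.mem_univ _, hy⟩)).differentiableAt (by simp)))

theorem SmoothPath.isSmoothFnFamily_velocity (γ : SmoothPath n X) :
    IsSmoothFnFamily γ.velocity := fun c =>
  (contDiffOn_fderiv_apply (isOpen_univ.prod (chartAt (Cn n) c).open_target)
    (γ.isSmoothFnFamily c) ((1 : ℝ), (0 : Cn n))).congr fun p hp =>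
      γ.localRep_velocity c p.1 hp.2

theorem IsSmoothFnFamily.iDeldbar {φ : ℝ → SmoothFn n X} (hφ : IsSmoothFnFamily φ) :
    DiffForm.IsSmoothFamily fun t => iDeldbar (φ t) := by
  intro c w
  have hU := isOpen_univ.prod (chartAt (Cn n) c).open_target (X := ℝ)
  have h2 : ∀ u w : Cn n, ContDiffOn ℝ ∞ (fun p : ℝ × Cn n =>
      fderiv ℝ (fun z => fderiv ℝ (localRep (φ p.1) (chartAt (Cn n) c)) z w) p.2 u)
      (Set.univ ×ˢ (chartAt (Cn n) c).target) := fun u w =>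
    (contDiffOn_fderiv_apply hU (contDiffOn_fderiv_apply hU (hφ c) (0, w)) (0, u)).congr
      fun p hp => fderiv_fderiv_localRep hφ c p.1 hp.2 u w
  refine (contDiffOn_const (c := Complex.I)).mul ((contDiffOn_const (c := Complex.I / 2)).mul
    ((h2 (w 0) (mulI n (w 1))).sub (h2 (w 1) (mulI n (w 0))))) |>.congr fun p hp => ?_
  rw [inChart_iDeldbar _ (chart_mem_atlas _ c) hp.2, ContinuousAlternatingMap.smul_apply,
    deldbar_apply (((contDiffOn_localRep _ (chart_mem_atlas _ c)).contDiffAt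
      ((chartAt (Cn n) c).open_target.mem_nhds hp.2)).of_le two_le_infty)]
  rfl

/-- The time derivative commutes with the two space derivatives occurring in ∂∂̄, by symmetry of
second derivatives on ℝ × ℂⁿ. -/
theorem SmoothPath.hasDerivAt_iDeldbar (γ : SmoothPath n X) (t : ℝ) (x : X)
    (w : Fin 2 → TangentSpace 𝓘(ℝ, Cn n) x) :
    HasDerivAt (fun s => iDeldbar (γ.toFun s) x w) (iDeldbar (γ.velocity t) x w) t := by
  have hy := mem_chart_target (Cn n) x
  have hU := isOpen_univ.prod (chartAt (Cn n) x).open_target (X := ℝ)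
  set e := chartAt (Cn n) x with he
  set G : ℝ × Cn n → ℂ := fun p => localRep (γ.toFun p.1) e p.2 with hGdef
  have hG : ContDiffOn ℝ ∞ G (Set.univ ×ˢ e.target) := γ.isSmoothFnFamily x
  have hnhds : ∀ {y}, y ∈ e.target → (Set.univ : Set ℝ) ×ˢ e.target ∈ nhds (t, y) := fun hy =>
    hU.mem_nhds ⟨Set.mem_univ _, hy⟩
  have h2 : ∀ u v : Cn n,
      HasDerivAt (fun s => fderiv ℝ (fun z => fderiv ℝ (localRep (γ.toFun s) e) z v) (e x) u)
        (fderiv ℝ (fun z => fderiv ℝ (localRep (γ.velocity t) e) z v) (e x) u) t := by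
    intro u v
    have e1 := fun s => fderiv_fderiv_localRep γ.isSmoothFnFamily x s hy u v
    have e2 := fderiv_fderiv_localRep γ.isSmoothFnFamily_velocity x t hy u v
    rw [← he] at e1 e2
    rw [funext e1, e2]
    have hGv := contDiffOn_fderiv_apply hU hG ((0 : ℝ), v)
    have hGvu := contDiffOn_fderiv_apply hU hGv ((0 : ℝ), u)
    refine (hasDerivAt_slice_left
      ((hGvu.contDiffAt (hnhds hy)).differentiableAt (by simp))).congr_deriv ?_
    -- Moves ∂_t past the outer space derivative; `hev` then moves it past the inner one, onto G,
    -- where it gives the velocity.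
    rw [fderiv_fderiv_comm ((hGv.contDiffAt (hnhds hy)).of_le two_le_infty)]
    have hev : (fun q => fderiv ℝ (fun z => fderiv ℝ G z ((0 : ℝ), v)) q ((1 : ℝ), (0 : Cn n)))
        =ᶠ[nhds (t, e x)] fun q => fderiv ℝ
          (fun p : ℝ × Cn n => localRep (γ.velocity p.1) e p.2) q ((0 : ℝ), v) := by
      filter_upwards [hnhds hy] with q hq
      rw [fderiv_fderiv_comm ((hG.contDiffAt (hU.mem_nhds hq)).of_le two_le_infty)]
      have : (fun z => fderiv ℝ G z ((1 : ℝ), (0 : Cn n))) =ᶠ[nhds q]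
          fun p : ℝ × Cn n => localRep (γ.velocity p.1) e p.2 := by
        filter_upwards [hU.mem_nhds hq] with p hp
        exact (γ.localRep_velocity x p.1 hp.2).symm
      rw [this.fderiv_eq]
    rw [hev.fderiv_eq]
  have h3 : ∀ φ : SmoothFn n X, iDeldbar φ x w = Complex.I * ((Complex.I / 2) *
      (fderiv ℝ (fun z => fderiv ℝ (localRep φ e) z (mulI n (w 1))) (e x) (w 0) -
        fderiv ℝ (fun z => fderiv ℝ (localRep φ e) z (mulI n (w 0))) (e x) (w 1))) := fun φ =>
    congrArg (Complex.I * ·) (deldbar_apply (((contDiffOn_localRep φ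
      (chart_mem_atlas _ x)).contDiffAt (e.open_target.mem_nhds hy)).of_le two_le_infty) w)
  simp only [h3]
  exact (((h2 _ _).sub (h2 _ _)).const_mul _).const_mul _

end FormFamilies

/-! ### Mixed powers B^j ∧ A^(n-j) and their derivatives. -/

section MixedPowers

variable {n : ℕ} {X : Type*} [TopologicalSpace X] [ChartedSpace (Cn n) X]

theorem complexified_alphaPhi (ω₀ α : TwoForm n X) (φ : SmoothFn n X) :
    complexified ω₀ (alphaPhi α φ) = fun x => complexified ω₀ α x + Complex.I • iDeldbar φ x :=
  funext fun x => ContinuousAlternatingMap.ext fun w => by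
    change ω₀ x w + Complex.I * (α x w + iDeldbar φ x w) =
      ω₀ x w + Complex.I * α x w + Complex.I * iDeldbar φ x w
    ring

/-- The factors of `B^j ∧ A^(n-j)`. -/
def mixedFactor (B A : TwoForm n X) (j : ℕ) (i : Fin n) : TwoForm n X := fun x =>
  if (i : ℕ) < j then B x else A x

theorem mixedFactor_of_lt (B A : TwoForm n X) {j : ℕ} {i : Fin n} (h : (i : ℕ) < j) :
    mixedFactor B A j i = B :=
  funext fun _ => if_pos h

theorem mixedFactor_of_not_lt (B A : TwoForm n X) {j : ℕ} {i : Fin n} (h : ¬(i : ℕ) < j) :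
    mixedFactor B A j i = A :=
  funext fun _ => if_neg h

theorem mixedPower_eq (B A : TwoForm n X) (j : ℕ) :
    mixedPower B A j = fun x => wedgeTwoForms fun i => mixedFactor B A j i x :=
  rfl

theorem mixedPower_self_degree (B A : TwoForm n X) : mixedPower B A n = topPower B := by
  funext x
  simp [mixedPower, topPower]

theorem isClosedOneOne_mixedFactor {A B : TwoForm n X} (hA : IsClosedOneOne A)
    (hB : IsClosedOneOne B) (j : ℕ) (i : Fin n) : IsClosedOneOne (mixedFactor B A j i) := by
  by_cases h : (i : ℕ) < j
  · rwa [mixedFactor_of_lt _ _ h]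
  · rwa [mixedFactor_of_not_lt _ _ h]

theorem isSmoothInCharts_mixedPower {A B : TwoForm n X} (hA : IsClosedOneOne A)
    (hB : IsClosedOneOne B) (j : ℕ) : DiffForm.IsSmoothInCharts (mixedPower B A j) :=
  DiffForm.IsSmoothInCharts.wedge fun i =>
    (isClosedOneOne_mixedFactor hA hB j i).smooth.isSmoothInCharts

/-- Replacing one factor `B` by `B - A` in `B^j ∧ A^(n-j)`. -/
theorem wedge_update_mixedFactor (B A : TwoForm n X) {j : ℕ} {i : Fin n} (hi : (i : ℕ) < j)
    (hj : j ≤ n) (x : X) :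
    wedgeTwoForms (Function.update (fun k => mixedFactor B A j k x) i (B x - A x)) =
      mixedPower B A j x - mixedPower B A (j - 1) x := by
  rw [wedgeTwoForms_update_sub]
  congr 1
  · rw [mixedPower_eq]
    congr 1
    have : B x = mixedFactor B A j i x := (if_pos hi).symm
    rw [this]
    exact Function.update_eq_self i fun k => mixedFactor B A j k x
  · rw [mixedPower_eq]
    -- The last slot occupied by B (j ≥ 1 because i < j). Since two-forms commute, the A inserted in
    -- slot i can be moved to slot l, giving the factors of B^(j-1) ∧ A^(n-j+1) in order.
    set l : Fin n := ⟨j - 1, by omega⟩ with hl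
    rw [← wedgeTwoForms_comp_perm _ (Equiv.swap i l)]
    congr 1
    funext k
    by_cases hki : k = i
    · subst hki
      rw [Equiv.swap_apply_left]
      by_cases hlk : l = k
      · have h1 : ¬((k : ℕ) < j - 1) := by rw [← hlk]; simp [hl]
        rw [hlk, Function.update_self]
        exact (if_neg h1).symm
      · have h1 : (k : ℕ) < j - 1 := by
          have : (k : ℕ) ≠ j - 1 := fun h => hlk (Fin.ext h.symm)
          omega
        have h2 : (l : ℕ) < j := by simp only [hl]; omega
        rw [Function.update_of_ne hlk]
        exact (if_pos h2).trans (if_pos h1).symm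
    · by_cases hkl : k = l
      · subst hkl
        rw [Equiv.swap_apply_right, Function.update_self]
        exact (if_neg (by simp [hl])).symm
      · rw [Equiv.swap_apply_of_ne_of_ne hki hkl, Function.update_of_ne hki]
        have h1 : (k : ℕ) ≠ j - 1 := fun h => hkl (Fin.ext h)
        have h2 : (k : ℕ) < j ↔ (k : ℕ) < j - 1 := by omega
        simp only [mixedFactor, h2]

variable [IsManifold 𝓘(ℂ, Cn n) ω X]

theorem IsClosedOneOne.add_iDeldbar {A : TwoForm n X} (hA : IsClosedOneOne A)
    (φ : SmoothFn n X) : IsClosedOneOne fun x => A x + Complex.I • iDeldbar φ x :=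
  hA.add_smul (isClosedOneOne_iDeldbar φ) Complex.I

theorem isSmoothFamily_mixedFactor {A : TwoForm n X} (hA : IsClosedOneOne A)
    {φ : ℝ → SmoothFn n X} (hφ : IsSmoothFnFamily φ) (j : ℕ) (i : Fin n) :
    DiffForm.IsSmoothFamily fun t =>
      mixedFactor (fun x => A x + Complex.I • iDeldbar (φ t) x) A j i := by
  by_cases h : (i : ℕ) < j
  · simp only [mixedFactor_of_lt _ _ h]
    exact hA.smooth.isSmoothInCharts.isSmoothFamily.add_const_smul hφ.iDeldbar Complex.I
  · simp only [mixedFactor_of_not_lt _ _ h]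
    exact hA.smooth.isSmoothInCharts.isSmoothFamily

theorem isSmoothFamily_mixedPower {A : TwoForm n X} (hA : IsClosedOneOne A)
    {φ : ℝ → SmoothFn n X} (hφ : IsSmoothFnFamily φ) (j : ℕ) :
    DiffForm.IsSmoothFamily fun t =>
      mixedPower (fun x => A x + Complex.I • iDeldbar (φ t) x) A j :=
  DiffForm.IsSmoothFamily.wedge fun i => isSmoothFamily_mixedFactor hA hφ j i

variable [T2Space X] [CompactSpace X]

theorem integralForm_sum {ι : Type*} (s : Finset ι) {η : ι → TopForm n X}
    (h : ∀ i ∈ s, DiffForm.IsSmoothInCharts (η i)) :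
    DiffForm.IsSmoothInCharts (fun x => ∑ i ∈ s, η i x) ∧
      integralForm (fun x => ∑ i ∈ s, η i x) = ∑ i ∈ s, integralForm (η i) := by
  classical
  induction s using Finset.induction_on with
  | empty =>
    refine ⟨fun c w => contDiffOn_const (c := (0 : ℂ)), ?_⟩
    simp only [Finset.sum_empty]
    exact integralForm_zero
  | insert a s ha ih =>
    obtain ⟨h1, h2⟩ := ih fun i hi => h i (Finset.mem_insert_of_mem hi)
    have h3 := h a (Finset.mem_insert_self a s)
    simp only [Finset.sum_insert ha]
    exact ⟨h3.add h1, by rw [integralForm_add h3 h1, h2]⟩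

/-- The derivative of `∫ γ_t A_t^j ∧ A^(n-j)`, `A_t = A + √-1 √-1∂∂̄γ_t`. -/
theorem hasDerivAt_integralForm_mixedPower {A : TwoForm n X} (hA : IsClosedOneOne A)
    (γ : SmoothPath n X) {j : ℕ} (hj : j ≤ n) (t : ℝ) :
    HasDerivAt (fun s => integralForm (fnMul (γ.toFun s)
        (mixedPower (fun x => A x + Complex.I • iDeldbar (γ.toFun s) x) A j)))
      (integralForm (fnMul (γ.velocity t)
          (mixedPower (fun x => A x + Complex.I • iDeldbar (γ.toFun t) x) A j)) +
        j * (integralForm (fnMul (γ.velocity t)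
            (mixedPower (fun x => A x + Complex.I • iDeldbar (γ.toFun t) x) A j)) -
          integralForm (fnMul (γ.velocity t)
            (mixedPower (fun x => A x + Complex.I • iDeldbar (γ.toFun t) x) A (j - 1))))) t := by
  set B : ℝ → TwoForm n X := fun s x => A x + Complex.I • iDeldbar (γ.toFun s) x with hB
  set ψ := γ.velocity t with hψ
  set φ := γ.toFun t with hφ
  have hBc : IsClosedOneOne (B t) := hA.add_iDeldbar _
  -- The derivative of the i-th factor is c i · √-1∂∂̄ψ: only the first j factors move. This lets
  -- the product rule run over all n slots uniformly.
  set c : Fin n → ℂ := fun i => if (i : ℕ) < j then Complex.I else 0 with hc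
  set S : SmoothFn n X → Fin n → TopForm n X := fun χ i x =>
    wedgeTwoForms (Function.update (fun k => mixedFactor (B t) A j k x) i (iDeldbar χ x)) with hS
  have hSs : ∀ (φ χ : SmoothFn n X) (i : Fin n), DiffForm.IsSmoothInCharts (fnMul φ (S χ i)) :=
    fun φ χ i => (isSmoothInCharts_update
      (fun k => (isClosedOneOne_mixedFactor hA hBc j k).smooth.isSmoothInCharts)
      (isClosedOneOne_iDeldbar χ).smooth.isSmoothInCharts i).fnMul φ
  have hMs : ∀ j, DiffForm.IsSmoothInCharts (fnMul ψ (mixedPower (B t) A j)) := fun j =>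
    (isSmoothInCharts_mixedPower hA hBc j).fnMul ψ
  have hsum := integralForm_sum (Finset.univ : Finset (Fin n))
    (η := fun i x => c i • fnMul φ (S ψ i) x) fun i _ => (hSs φ ψ i).const_smul (c i)
  have hder : HasDerivAt (fun s => integralForm (fnMul (γ.toFun s) (mixedPower (B s) A j)))
      (integralForm fun x => fnMul ψ (mixedPower (B t) A j) x +
        ∑ i, c i • fnMul φ (S ψ i) x) t := by
    refine hasDerivAt_integralForm ((isSmoothFamily_mixedPower hA γ.isSmoothFnFamily j).fnMul
      γ.isSmoothFnFamily) fun x w => ?_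
    have h1 : ∀ (i : Fin n) (v : Fin 2 → TangentSpace 𝓘(ℝ, Cn n) x),
        HasDerivAt (fun s => mixedFactor (B s) A j i x v) ((c i • iDeldbar ψ x) v) t := by
      intro i v
      by_cases h : (i : ℕ) < j
      · simp only [mixedFactor_of_lt _ _ h, hc, if_pos h]
        exact ((γ.hasDerivAt_iDeldbar t x v).const_mul Complex.I).const_add (A x v)
      · simp only [mixedFactor_of_not_lt _ _ h, hc, if_neg h]
        refine (hasDerivAt_const t (A x v)).congr_deriv ?_
        exact (zero_mul _).symm
    have h2 := hasDerivAt_wedgeTwoForms h1 w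
    have h3 := ((γ.hasDerivAt t x).ofReal_comp).fun_mul h2
    have h4 : ∀ s, fnMul (γ.toFun s) (mixedPower (B s) A j) x w =
        ((γ.toFun s x : ℝ) : ℂ) * wedgeTwoForms (fun i => mixedFactor (B s) A j i x) w :=
      fun s => Complex.real_smul
    refine (h3.congr_deriv ?_).congr_of_eventuallyEq (Filter.Eventually.of_forall h4)
    rw [ContinuousAlternatingMap.add_apply, ContinuousAlternatingMap.sum_apply, Finset.mul_sum]
    congr 1
    refine Finset.sum_congr rfl fun i _ => ?_
    rw [wedgeTwoForms_update_smul]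
    change _ * (c i * S ψ i x w) = c i * (φ x • S ψ i x w)
    rw [Complex.real_smul]
    ring
  refine hder.congr_deriv ?_
  rw [integralForm_add (hMs j) hsum.1, hsum.2]
  congr 1
  -- Symmetry moves √-1∂∂̄ from ψ to φ; then √-1 · √-1∂∂̄φ = B - A, and the integral becomes a
  -- difference of consecutive mixed powers.
  have hterm : ∀ i : Fin n, integralForm (fun x => c i • fnMul φ (S ψ i) x) =
      if (i : ℕ) < j then integralForm (fnMul ψ (mixedPower (B t) A j)) -
        integralForm (fnMul ψ (mixedPower (B t) A (j - 1))) else 0 := by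
    intro i
    rw [integralForm_const_smul, integralForm_wedge_iDeldbar_comm
      (fun k => isClosedOneOne_mixedFactor hA hBc j k) φ ψ i]
    by_cases h : (i : ℕ) < j
    · simp only [hc, if_pos h]
      rw [← integralForm_const_smul, ← integralForm_sub (hMs j) (hMs (j - 1))]
      refine congrArg integralForm (funext fun x => ContinuousAlternatingMap.ext fun w => ?_)
      have h1 := wedge_update_mixedFactor (B t) A h hj x
      have h2 : B t x - A x = Complex.I • iDeldbar φ x := by
        simp only [hB]
        exact add_sub_cancel_left _ _
      rw [h2, wedgeTwoForms_update_smul] at h1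
      have h3 := congrArg (fun f : TangentSpace 𝓘(ℝ, Cn n) x [⋀^Fin n × Fin 2]→L[ℝ] ℂ =>
        ψ x • f w) h1
      change Complex.I * (ψ x • S φ i x w) =
        ψ x • mixedPower (B t) A j x w - ψ x • mixedPower (B t) A (j - 1) x w
      change ψ x • (Complex.I * S φ i x w) =
        ψ x • (mixedPower (B t) A j x w - mixedPower (B t) A (j - 1) x w) at h3
      rw [← smul_sub, ← h3]
      exact mul_smul_comm _ _ _
    · simp only [hc, if_neg h, zero_mul]
  rw [Finset.sum_congr rfl fun i _ => hterm i, ← Finset.sum_filter, Finset.sum_const,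
    nsmul_eq_mul]
  congr 2
  have : (Finset.univ.filter fun i : Fin n => (i : ℕ) < j).card = j := by
    rw [Fin.card_filter_val_lt]
    exact min_eq_right hj
  exact this

/-- The j-th term is (j+1) a_j - j a_(j-1). At j = 0 the truncated index j - 1 is harmless, its
coefficient being 0. -/
theorem sum_telescope (a : ℕ → ℂ) (n : ℕ) :
    ∑ j ∈ Finset.range (n + 1), (a j + j * (a j - a (j - 1))) = (n + 1) * a n := by
  induction n with
  | zero => simp
  | succ k ih =>
    rw [Finset.sum_range_succ, ih]
    rw [Nat.add_sub_cancel]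
    push_cast
    ring

end MixedPowers

/-! ### Primitives of the 1-form and the functional on 𝓗. -/

section CalabiYauFunctional

variable {n : ℕ} {X : Type*} [TopologicalSpace X] [ChartedSpace (Cn n) X]

theorem IsKahlerForm.isClosedOneOne_complexified {ω₀ α : TwoForm n X} (hω : IsKahlerForm ω₀)
    (hα : IsClosedRealOneOne α) : IsClosedOneOne (complexified ω₀ α) :=
  hω.isClosedOneOne.add_smul hα.isClosedOneOne Complex.I

/-- The straight path between two functions. -/
noncomputable def linePath (φ₀ φ₁ : SmoothFn n X) : SmoothPath n X where
  toFun t := φ₀ + t • (φ₁ - φ₀)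
  smooth := by
    have h0 : ContMDiff (𝓘(ℝ, ℝ).prod 𝓘(ℝ, Cn n)) 𝓘(ℝ, ℝ) ∞ fun p : ℝ × X => φ₀ p.2 :=
      φ₀.contMDiff.comp contMDiff_snd
    have h1 : ContMDiff (𝓘(ℝ, ℝ).prod 𝓘(ℝ, Cn n)) 𝓘(ℝ, ℝ) ∞ fun p : ℝ × X => (φ₁ - φ₀) p.2 :=
      (φ₁ - φ₀).contMDiff.comp contMDiff_snd
    exact h0.add (contMDiff_fst.smul h1)

theorem linePath_zero (φ₀ φ₁ : SmoothFn n X) : (linePath φ₀ φ₁).toFun 0 = φ₀ := by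
  simp [linePath]

theorem linePath_one (φ₀ φ₁ : SmoothFn n X) : (linePath φ₀ φ₁).toFun 1 = φ₁ := by
  simp [linePath]

variable [IsManifold 𝓘(ℂ, Cn n) ω X]

theorem IsPrimitive.sub_const {F : SmoothFn n X → ℂ} {θ : SmoothFn n X → SmoothFn n X → ℂ}
    (hF : IsPrimitive F θ) (a : ℂ) : IsPrimitive (fun φ => F φ - a) θ := fun γ t =>
  (hF γ t).sub_const a

/-- Along the straight path from φ₀ to φ the difference of two primitives has zero derivative. -/
theorem IsPrimitive.eq_of_eq {F G : SmoothFn n X → ℂ} {θ : SmoothFn n X → SmoothFn n X → ℂ}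
    (hF : IsPrimitive F θ) (hG : IsPrimitive G θ) {φ₀ : SmoothFn n X} (h0 : F φ₀ = G φ₀) :
    F = G := by
  funext φ
  set γ := linePath φ₀ φ with hγ
  have h : ∀ t, HasDerivAt (fun s => F (γ.toFun s) - G (γ.toFun s)) 0 t := fun t =>
    ((hF γ t).fun_sub (hG γ t)).congr_deriv (sub_self _)
  have := is_const_of_deriv_eq_zero (fun t => (h t).differentiableAt) (fun t => (h t).deriv) 1 0
  simp only [hγ, linePath_zero, linePath_one, h0, sub_self] at this
  exact sub_eq_zero.mp this

variable [T2Space X] [CompactSpace X]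

/-- Summing the derivatives of the mixed integrals telescopes to (n+1) times the term j = n, where
the mixed power is the full n-th power; the prefactor 1/(n+1) cancels. -/
theorem isPrimitive_explicitCY {ω₀ α : TwoForm n X} (hA : IsClosedOneOne (complexified ω₀ α)) :
    IsPrimitive (explicitCY ω₀ α) (dCY ω₀ α) := by
  intro γ t
  simp only [explicitCY, dCY, complexified_alphaPhi]
  have h := (HasDerivAt.fun_sum (u := Finset.range (n + 1)) fun j hj =>
    hasDerivAt_integralForm_mixedPower hA γ (Nat.lt_succ_iff.1 (Finset.mem_range.1 hj)) t).const_mul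
      (1 / ((n : ℂ) + 1))
  refine h.congr_deriv ?_
  rw [sum_telescope (fun j => integralForm (fnMul (γ.velocity t)
    (mixedPower (fun x => complexified ω₀ α x + Complex.I • iDeldbar (γ.toFun t) x)
      (complexified ω₀ α) j))), mixedPower_self_degree, ← mul_assoc,
    one_div_mul_cancel (Nat.cast_add_one_ne_zero n), one_mul]

theorem continuous_dCY_path {ω₀ α : TwoForm n X} (hA : IsClosedOneOne (complexified ω₀ α))
    (γ : SmoothPath n X) : Continuous fun t => dCY ω₀ α (γ.toFun t) (γ.velocity t) := by
  simp only [dCY, complexified_alphaPhi,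
    ← mixedPower_self_degree _ (complexified ω₀ α)]
  exact continuous_integralForm
    ((isSmoothFamily_mixedPower hA γ.isSmoothFnFamily n).fnMul γ.isSmoothFnFamily_velocity)

/-- The fundamental theorem of calculus along γ, applicable since the derivative of F along γ is
continuous in t. -/
theorem IsPrimitive.isCYFunctional {ω₀ α : TwoForm n X}
    (hA : IsClosedOneOne (complexified ω₀ α)) {F : SmoothFn n X → ℂ}
    (hF : IsPrimitive F (dCY ω₀ α)) {φ₀ : SmoothFn n X} (h0 : F φ₀ = 0) :
    IsCYFunctional ω₀ α φ₀ fun φ => F φ := by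
  intro φ₁ γ hγ0 hγ1
  have hi := (continuous_dCY_path hA γ).intervalIntegrable (μ := MeasureTheory.volume) 0 1
  refine ⟨hi, ?_⟩
  rw [intervalIntegral.integral_eq_sub_of_hasDerivAt (fun t _ => hF γ t) hi, hγ0, hγ1, h0,
    sub_zero]

/-- The straight path already determines the value. It may leave 𝓗, as paths are taken in all of
C^∞(X, ℝ), so no convexity or connectedness of 𝓗 enters. -/
theorem IsCYFunctional.unique {ω₀ α : TwoForm n X} {φ₀ : SmoothFn n X}
    {CY CY' : spaceH ω₀ α → ℂ} (h : IsCYFunctional ω₀ α φ₀ CY)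
    (h' : IsCYFunctional ω₀ α φ₀ CY') : CY = CY' :=
  funext fun φ₁ =>
    ((h φ₁ (linePath φ₀ φ₁) (linePath_zero _ _) (linePath_one _ _)).2).trans
      ((h' φ₁ (linePath φ₀ φ₁) (linePath_zero _ _) (linePath_one _ _)).2).symm

theorem explicitCY_zero (ω₀ α : TwoForm n X) : explicitCY ω₀ α 0 = 0 := by
  have h : ∀ η : TopForm n X, fnMul (0 : SmoothFn n X) η = fun _ => 0 := fun η =>
    funext fun x => ContinuousAlternatingMap.ext fun _ => zero_smul ℝ (_ : ℂ)
  simp only [explicitCY, h, integralForm_zero, Finset.sum_const_zero, mul_zero]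

end CalabiYauFunctional

theorem mainTheorem10 {n : ℕ} {X : Type*} [TopologicalSpace X] [T2Space X] [CompactSpace X]
    [ChartedSpace (Cn n) X] [IsManifold 𝓘(ℂ, Cn n) ω X]
    (ω₀ α : TwoForm n X) (hω : IsKahlerForm ω₀) (hα : IsClosedRealOneOne α)
    (hZ : totalIntegral ω₀ α ≠ 0) :
    -- the 1-form is exact on `C^∞(X, ℝ)`, with a primitive that is unique once normalised
    (∀ φ₀ : SmoothFn n X, ∃! F : SmoothFn n X → ℂ, F φ₀ = 0 ∧ IsPrimitive F (dCY ω₀ α)) ∧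
    -- it integrates along paths to a well-defined functional on `𝓗`, the restriction of a primitive
    (∀ φ₀ ∈ spaceH ω₀ α, ∃! CY : spaceH ω₀ α → ℂ, IsCYFunctional ω₀ α φ₀ CY) ∧
    (∀ φ₀ ∈ spaceH ω₀ α, ∀ F : SmoothFn n X → ℂ, F φ₀ = 0 → IsPrimitive F (dCY ω₀ α) →
      IsCYFunctional ω₀ α φ₀ fun φ => F φ) ∧
    -- the explicit formula
    (∀ F : SmoothFn n X → ℂ, F 0 = 0 → IsPrimitive F (dCY ω₀ α) → ∀ φ, F φ = explicitCY ω₀ α φ) ∧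
    ((0 : SmoothFn n X) ∈ spaceH ω₀ α → ∀ CY : spaceH ω₀ α → ℂ, IsCYFunctional ω₀ α 0 CY →
      ∀ φ : spaceH ω₀ α, CY φ = explicitCY ω₀ α φ) := by
  have hA := hω.isClosedOneOne_complexified hα
  have hE := isPrimitive_explicitCY hA
  -- The explicit primitive minus its value at φ₀ is the normalised primitive at φ₀, and it serves
  -- as witness for both existence claims.
  refine ⟨fun φ₀ => ⟨fun φ => explicitCY ω₀ α φ - explicitCY ω₀ α φ₀,
      ⟨sub_self _, hE.sub_const _⟩, fun F hF => hF.2.eq_of_eq (hE.sub_const _) (φ₀ := φ₀) ?_⟩,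
    fun φ₀ _ => ⟨fun φ => explicitCY ω₀ α φ - explicitCY ω₀ α φ₀,
      (hE.sub_const _).isCYFunctional hA (sub_self _), fun CY hCY => hCY.unique
        ((hE.sub_const _).isCYFunctional hA (sub_self _))⟩,
    fun φ₀ _ F h0 hF => hF.isCYFunctional hA h0,
    fun F h0 hF φ => congrFun (hF.eq_of_eq hE (h0.trans (explicitCY_zero ω₀ α).symm)) φ,
    fun _ CY hCY φ => congrFun (hCY.unique (hE.isCYFunctional hA (explicitCY_zero ω₀ α))) φ⟩
  rw [hF.1, sub_self]
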